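/- **Setting.** A GPT is a tuple $(A,\Omega_A,u_A,\mathcal G_A)$, where $A$ is a finite-dimensional real vector space, $\Omega_A\subset A$ (the states) is convex and compact, $A_+:=\mathbb R_{\ge 0}\cdot\Omega_A$ is a closed, pointed, generating convex cone, $u_A\in A^*$ is strictly positive on $A_+\setminus\{0\}$ with $\Omega_A=\{w\in A_+ : u_A(w)=1\}$, and $\mathcal G_A$ (the reversible transformations) is a group of invertible linear maps $T$ on $A$ with $T(A_+)\subseteq A_+$ and $u_A\circ T\le u_A$ on $A_+$. Pure states are the extreme points of $\Omega_A$. Effects are the $e\in A^*$ with $0\le e\le u_A$ on $A_+$; a measurement is a finite family of effects with sum $u_A$. A measurement is fine-grained if, whenever it is obtained from a measurement $(e'_j)$ by merging outcomes along a map $M$ (i.e. $e_k=\sum_{M(j)=k}e'_j$), every $e'_j$ is proportional to $e_{M(j)}$. An $n$-frame is a family of $n$ pure states $w_1,\dots,w_n$ which are perfectly distinguishable, i.e. there are effects $e_1,\dots,e_n$ with $\sum_j e_j\le u_A$ on $A_+$ and $e_j(w_k)=\delta_{jk}$. A classical decomposition of a state $w$ is $w=\sum_j p_jw_j$ with $(p_j)$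 a probability distribution and $(w_j)$ a frame. A face of $A_+$ is a non-empty convex $F\subseteq A_+$ such that $pv+(1-p)w\in F$ with $v,w\in A_+$, $0<p<1$ implies $v,w\in F$; the face generated by a set is the smallest face containing it. The rank $|F|$ of a face is the size of a frame generating $F$. For a probability distribution $p$ let $H_0(p)=\log_2|\{j: p_j>0\}|$. For $w\in\Omega_A$ let - $H_0(w)=H_0(p)$ for a classical decomposition $w=\sum_j p_jw_j$ (spectral max-entropy); - $\widecheck H_0(w)=\inf H_0(q)$ over all finite convex decompositions $w=\sum_j q_jv_j$ into pure states $v_j$ (order-0 Rényi decomposition entropy); - $\widehat H_0(w)=\inf H_0(e_1(w),e_2(w),\dots)$ over all fine-grained measurements (order-0 Rényi measurement entropy). *Postulate 1:* every state has a classical decomposition. *Postulate 2:* for every $n$ and any two $n$-frames $(w_j)$, $(v_j)$ there is $T\in\mathcal G_A$ with $Tw_j=v_j$ for all $j$. *Covering property:* for every face $F$ of $A_+$ and every pure state $w$, the smallest face $G$ containing $F$ and $w$ is either $F$, or $F\subsetneq G$ and there is no face $H$ with $F\subsetneq H\subsetneq G$. **Theorem.** Let a GPT satisfy Postulates 1 and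 2. Then every face of $A_+$ is generated by a frame, any two frames generating the same face have the same size (so ranks are well defined), and $H_0(w)$ does not depend on the classical decomposition of $w$ used. Moreover: 1. If the covering property holds and $v_1,\dots,v_n$ are pure states, then the face generated by them has rank at most $n$, and every state in it has a classical decomposition into at most $n$ pure states. 2. The covering property holds if and only if $|G|\le|F|+1$ for every face $F$ of $A_+$ and every pure state $w$, where $G$ is the face generated by $F$ and $w$. 3. The covering property holds if and only if $\widecheck H_0(w)=\widehat H_0(w)=H_0(w)$ for all $w\in\Omega_A$. 4. The covering property holds if and only if $\widecheck H_0(w)=H_0(w)$ for all $w\in\Omega_A$. -/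

import Mathlib

noncomputable section

/-! Convex geometry: cones and faces. -/

/-- `ℝ_{≥ 0} · M`, the set of all non-negative multiples of elements of `M`. -/
def nonnegMultiples {A : Type*} [AddCommGroup A] [Module ℝ A] (M : Set A) : Set A :=
  {x | ∃ r : ℝ, 0 ≤ r ∧ ∃ w ∈ M, x = r • w}

/-- A (pointed convex) cone: a non-empty set `K` with `K + K ⊆ K`, `p K ⊆ K` for all `p ≥ 0`,
and `K ∩ (-K) = {0}`. -/
structure IsPointedConvexCone {A : Type*} [AddCommGroup A] [Module ℝ A] (K : Set A) : Prop where
  nonempty : K.Nonempty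
  add_mem : ∀ x ∈ K, ∀ y ∈ K, x + y ∈ K
  smul_mem : ∀ p : ℝ, 0 ≤ p → ∀ x ∈ K, p • x ∈ K
  pointed : ∀ x, x ∈ K → -x ∈ K → x = 0

/-- A face of a convex set `C`: a non-empty convex subset `F` of `C` such that
`p v + (1 - p) w ∈ F` with `v, w ∈ C` and `0 < p < 1` implies `v, w ∈ F`. -/
structure IsFace {A : Type*} [AddCommGroup A] [Module ℝ A] (C F : Set A) : Prop where
  nonempty : F.Nonempty
  convex : Convex ℝ F
  isExtreme : IsExtreme ℝ C F

/-- The face of `C` generated by `M`: the intersection of all faces of `C` containing `M`. -/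
def generatedFace {A : Type*} [AddCommGroup A] [Module ℝ A] (C M : Set A) : Set A :=
  ⋂₀ {H | IsFace C H ∧ M ⊆ H}

/-! Classical probability distributions and their max-entropy. -/

/-- `(p_1, …, p_n)` is a probability distribution. -/
def IsProbDist {n : ℕ} (p : Fin n → ℝ) : Prop :=
  (∀ i, 0 ≤ p i) ∧ ∑ i, p i = 1

/-- The classical Rényi entropy of order `0`: `H_0(p) = log₂ |{j | p_j > 0}|`. -/
def classicalMaxEntropy {n : ℕ} (p : Fin n → ℝ) : ℝ :=
  Real.logb 2 (Set.ncard {i : Fin n | 0 < p i} : ℝ)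

/-- A generalized probabilistic theory `(A, Ω_A, u_A, 𝒢_A)`: an abstract state space together
with its group of (physically allowed) reversible transformations. -/
structure GPT (A : Type*) [NormedAddCommGroup A] [NormedSpace ℝ A] where
  /-- the set `Ω_A` of normalized states -/
  states : Set A
  /-- the order unit `u_A` -/
  unit : Module.Dual ℝ A
  /-- the group `𝒢_A` of reversible transformations -/
  reversible : Subgroup (A ≃ₗ[ℝ] A)
  convex_states : Convex ℝ states
  isCompact_states : IsCompact states
  isCone : IsPointedConvexCone (nonnegMultiples states)
  isClosed_cone : IsClosed (nonnegMultiples states)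
  generating : Submodule.span ℝ (nonnegMultiples states) = ⊤
  unit_pos : ∀ w ∈ nonnegMultiples states, w ≠ 0 → 0 < unit w
  unit_eq_one_iff : ∀ w ∈ nonnegMultiples states, (unit w = 1 ↔ w ∈ states)
  /-- reversible transformations are positive (so are their inverses, by the group property) -/
  reversible_pos : ∀ T ∈ reversible, ∀ w ∈ nonnegMultiples states, T w ∈ nonnegMultiples states
  /-- reversible transformations do not increase the normalization -/
  reversible_unit_le : ∀ T ∈ reversible, ∀ w ∈ nonnegMultiples states, unit (T w) ≤ unit w

namespace GPT

variable {A : Type*} [NormedAddCommGroup A] [NormedSpace ℝ A] (S : GPT A)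

/-- The cone `A_+` of unnormalized states. -/
def cone : Set A := nonnegMultiples S.states

/-- Pure states: the extreme points of the set of states. -/
def pureStates : Set A := S.states.extremePoints ℝ

/-- Effects: linear functionals `e` with `0 ≤ e ≤ u_A` on `A_+`. -/
def IsEffect (e : Module.Dual ℝ A) : Prop :=
  ∀ w ∈ S.cone, 0 ≤ e w ∧ e w ≤ S.unit w

/-- Measurements: finite families of effects that sum to the order unit. -/
def IsMeasurement {n : ℕ} (e : Fin n → Module.Dual ℝ A) : Prop :=
  (∀ j, S.IsEffect (e j)) ∧ ∑ j, e j = S.unit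

/-- `e'` is a refinement of `e` along `M`: outcome `k` of `e` collects the outcomes `j` of `e'`
with `M j = k`. -/
def IsRefinement {m n : ℕ} (e' : Fin m → Module.Dual ℝ A) (e : Fin n → Module.Dual ℝ A)
    (M : Fin m → Fin n) : Prop :=
  S.IsMeasurement e' ∧ ∀ k, ∑ j with M j = k, e' j = e k

/-- A measurement is fine-grained if all its refinements are trivial, i.e. only replace outcomes
by outcomes proportional to them. -/
def IsFineGrained {n : ℕ} (e : Fin n → Module.Dual ℝ A) : Prop :=
  S.IsMeasurement e ∧
    ∀ (m : ℕ) (e' : Fin m → Module.Dual ℝ A) (M : Fin m → Fin n),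
      S.IsRefinement e' e M → ∀ j, ∃ c : ℝ, e' j = c • e (M j)

/-- States `w_1, …, w_n` are perfectly distinguishable if there are effects `e_1, …, e_n` with
`∑ e_j ≤ u_A` and `e_j(w_k) = δ_{jk}`. -/
def PerfectlyDistinguishable {n : ℕ} (w : Fin n → A) : Prop :=
  (∀ k, w k ∈ S.states) ∧
    ∃ e : Fin n → Module.Dual ℝ A,
      (∀ j, S.IsEffect (e j)) ∧ (∀ x ∈ S.cone, ∑ j, e j x ≤ S.unit x) ∧
        ∀ j k, e j (w k) = if j = k then 1 else 0

/-- An `n`-frame: `n` perfectly distinguishable pure states. -/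
def IsFrame {n : ℕ} (w : Fin n → A) : Prop :=
  (∀ k, w k ∈ S.pureStates) ∧ S.PerfectlyDistinguishable w

/-- `w = ∑ q_j v_j` is a convex decomposition of `w` into pure states. -/
def IsPureDecomposition {n : ℕ} (w : A) (q : Fin n → ℝ) (v : Fin n → A) : Prop :=
  IsProbDist q ∧ (∀ j, v j ∈ S.pureStates) ∧ w = ∑ j, q j • v j

/-- `w = ∑ p_j w_j` is a classical decomposition of `w`, i.e. a convex decomposition into
perfectly distinguishable pure states. -/
def IsClassicalDecomposition {n : ℕ} (w : A) (p : Fin n → ℝ) (v : Fin n → A) : Prop :=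
  IsProbDist p ∧ S.IsFrame v ∧ w = ∑ j, p j • v j

/-- Classical decomposability (weak spectrality): every state has a classical decomposition. -/
def ClassicalDecomposability : Prop :=
  ∀ w ∈ S.states, ∃ (n : ℕ) (p : Fin n → ℝ) (v : Fin n → A), S.IsClassicalDecomposition w p v

/-- Strong symmetry: any `n`-frame can be mapped to any other `n`-frame by a
reversible transformation. -/
def StrongSymmetry : Prop :=
  ∀ (n : ℕ) (w v : Fin n → A), S.IsFrame w → S.IsFrame v →
    ∃ T ∈ S.reversible, ∀ j, T (w j) = v j

/-- The smallest face of `A_+` containing the face `F` and the state `w` (equivalently, containing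
`F` and the face `ℝ_{≥ 0} · w` given by `w`). -/
def faceJoin (F : Set A) (w : A) : Set A := generatedFace S.cone (F ∪ {w})

/-- The covering property: for every face `F` of `A_+` and every pure state `w`, the smallest face
`G` containing both is either `F` itself, or it is strictly larger than `F` and no face lies
strictly between `F` and `G`. -/
def CoveringProperty : Prop :=
  ∀ F : Set A, IsFace S.cone F → ∀ w ∈ S.pureStates,
    S.faceJoin F w = F ∨
      (F ⊂ S.faceJoin F w ∧
        ¬ ∃ H : Set A, IsFace S.cone H ∧ F ⊂ H ∧ H ⊂ S.faceJoin F w)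

/-- The face `F` of `A_+` is generated by a frame of size `n`. -/
def GeneratedByFrame (F : Set A) (n : ℕ) : Prop :=
  ∃ w : Fin n → A, S.IsFrame w ∧ generatedFace S.cone (Set.range w) = F

/-- The rank `|F|` of a face `F` of `A_+`: the size of a frame generating `F`. -/
def rank (F : Set A) : ℕ := sInf {n | S.GeneratedByFrame F n}

/-- The spectral max-entropy `H_0(w)`: the max-entropy of the coefficients of a classical
decomposition of `w` (written as an infimum over all classical decompositions). -/
def spectralMaxEntropy (w : A) : ℝ :=
  sInf {h | ∃ (n : ℕ) (p : Fin n → ℝ) (v : Fin n → A),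
    S.IsClassicalDecomposition w p v ∧ h = classicalMaxEntropy p}

/-- The order-`0` Rényi decomposition entropy: the infimum of `H_0(q)` over all convex
decompositions `w = ∑ q_j v_j` into pure states. -/
def decompositionMaxEntropy (w : A) : ℝ :=
  sInf {h | ∃ (n : ℕ) (q : Fin n → ℝ) (v : Fin n → A),
    S.IsPureDecomposition w q v ∧ h = classicalMaxEntropy q}

/-- The order-`0` Rényi measurement entropy: the infimum of `H_0(e_1(w), e_2(w), …)` over all
fine-grained measurements. -/
def measurementMaxEntropy (w : A) : ℝ :=
  sInf {h | ∃ (n : ℕ) (e : Fin n → Module.Dual ℝ A),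
    S.IsFineGrained e ∧ h = classicalMaxEntropy (fun j => e j w)}

end GPT

end

/-! The two postulates force the cone to be self-dual, and then all three entropies of order zero
are governed by ranks of faces.

Self-duality: there is an inner product invariant under all linear bijections preserving the states.
The state of least norm is fixed by every reversible transformation, so strong symmetry makes all
coefficients in its classical decomposition equal; rescaled, it is an invariant frame sum `U`. That
frame is maximal, and every vector is diagonal in some reversible image of it. Correcting the inner
product by a multiple of `u ⊗ u` makes frames orthonormal, and two pure states with negative inner
product would form a frame, hence be orthogonal (`isSelfDualForm_of_invariant`).

Ranks: the sum of a frame acts as the order unit on the face it generates, so it depends on the face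
only and its size is the rank. Faces are self-dual in their span, so frames extend inside faces
(`IsSelfDualForm.exists_extension`) and rank is strictly monotone. Covering thus means that a pure
state adds at most one to the rank.

Entropies: `H_0(w)` is the logarithm of the rank of the face of `w`. A pure decomposition of `w`
generates the same face, so covering bounds the rank by the number of terms; conversely a uniform
mixture of a pure state and a frame of `F` tests the rank bound. For fine-grained measurements, the
outcomes with positive probability together with the face orthogonal to `w` generate the cone, and
the ranks of the faces of `w` and `wᗮ` add up to at most that of the cone. -/

/-! ### An inner product invariant under the symmetries of a bounded set. -/

open MeasureTheory in
-- Integrate the rank-one forms `f x * f y` over the absolute polar `E` of `Ω`. A symmetry of `Ω`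
-- acts on the dual preserving `E`, and `E` has positive finite Haar measure, so this action
-- preserves the measure. No averaging over a group is needed.
theorem exists_invariant_posDef_form {A : Type*} [NormedAddCommGroup A] [NormedSpace ℝ A]
    [FiniteDimensional ℝ A] (Ω : Set A) (hbdd : Bornology.IsBounded Ω)
    (hspan : Submodule.span ℝ Ω = ⊤) :
    ∃ B : A →ₗ[ℝ] A →ₗ[ℝ] ℝ, (∀ x y, B x y = B y x) ∧ (∀ x, x ≠ 0 → 0 < B x x) ∧
      ∀ T : A ≃ₗ[ℝ] A, (∀ w, T w ∈ Ω ↔ w ∈ Ω) → ∀ x y, B (T x) (T y) = B x y := by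
  let D := StrongDual ℝ A
  let _ : MeasurableSpace D := borel D
  have : BorelSpace D := ⟨rfl⟩
  let μ : Measure D := Measure.addHaar
  let E : Set D := {f | ∀ w ∈ Ω, |f w| ≤ 1}
  have hclosed : IsClosed E := by
    have : E = ⋂ w ∈ Ω, {f : D | |f w| ≤ 1} := by ext f; simp [E]
    rw [this]
    exact isClosed_biInter fun w _ => isClosed_le
      ((ContinuousLinearMap.apply ℝ ℝ w).continuous.abs) continuous_const
  -- `Ω` contains a basis of `A`; evaluating functionals on it is injective, hence antilipschitz,
  -- and sends `E` into the unit ball.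
  have hEbdd : Bornology.IsBounded E := by
    obtain ⟨b, hbΩ, hbspan, hbli⟩ := exists_linearIndependent ℝ Ω
    have : Finite b := hbli.finite
    have : Fintype b := Fintype.ofFinite b
    let Φ : D →L[ℝ] (b → ℝ) :=
      ContinuousLinearMap.pi fun i => ContinuousLinearMap.apply ℝ ℝ (i : A)
    have hinj : LinearMap.ker (Φ : D →ₗ[ℝ] (b → ℝ)) = ⊥ := by
      rw [LinearMap.ker_eq_bot']
      intro f hf
      have h0 : ∀ x ∈ Submodule.span ℝ b, f x = 0 := by
        intro x hx
        induction hx using Submodule.span_induction with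
        | mem x hx => exact congrFun hf ⟨x, hx⟩
        | zero => simp
        | add x y _ _ hx hy => simp [hx, hy]
        | smul a x _ hx => simp [hx]
      ext x
      exact h0 x (by rw [hbspan, hspan]; trivial)
    obtain ⟨K, _, hK⟩ := (Φ : D →ₗ[ℝ] (b → ℝ)).exists_antilipschitzWith hinj
    have himg : Bornology.IsBounded (Φ ⁻¹' (Metric.closedBall 0 1)) :=
      hK.isBounded_preimage Metric.isBounded_closedBall
    refine himg.subset fun f hf => ?_
    simp only [Set.mem_preimage, Metric.mem_closedBall, dist_zero_right]
    exact (pi_norm_le_iff_of_nonneg zero_le_one).2 fun i => hf i (hbΩ i.2)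
  have hEcomp : IsCompact E := Metric.isCompact_of_isClosed_isBounded hclosed hEbdd
  obtain ⟨r, hr, hball⟩ : ∃ r > 0, Metric.ball (0 : D) r ⊆ E := by
    obtain ⟨R, hR0, hR⟩ := hbdd.exists_pos_norm_le
    refine ⟨1 / R, by positivity, fun f hf w hw => ?_⟩
    rw [mem_ball_zero_iff] at hf
    calc |f w| ≤ ‖f‖ * ‖w‖ := f.le_opNorm w
      _ ≤ 1 / R * R := by gcongr; exact hR w hw
      _ = 1 := by field_simp
  have hcont : ∀ x y : A, Continuous fun f : D => f x * f y := fun x y =>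
    ((ContinuousLinearMap.apply ℝ ℝ x).continuous).mul (ContinuousLinearMap.apply ℝ ℝ y).continuous
  have hint : ∀ x y : A, IntegrableOn (fun f : D => f x * f y) E μ := fun x y =>
    (hcont x y).continuousOn.integrableOn_compact hEcomp
  let B : A →ₗ[ℝ] A →ₗ[ℝ] ℝ := LinearMap.mk₂ ℝ (fun x y => ∫ f in E, f x * f y ∂μ)
    (fun x x' y => by
      rw [← integral_add (hint x y) (hint x' y)]
      simp only [map_add, add_mul])
    (fun c x y => by
      rw [smul_eq_mul, ← integral_const_mul]
      simp only [map_smul, smul_eq_mul, mul_assoc])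
    (fun x y y' => by
      rw [← integral_add (hint x y) (hint x y')]
      simp only [map_add, mul_add])
    (fun c x y => by
      rw [smul_eq_mul, ← integral_const_mul]
      simp only [map_smul, smul_eq_mul, mul_left_comm])
  have hB : ∀ x y, B x y = ∫ f in E, f x * f y ∂μ := fun _ _ => rfl
  refine ⟨B, fun x y => by simp only [hB, mul_comm], fun x hx => ?_, fun T hT x y => ?_⟩
  · rw [hB, setIntegral_pos_iff_support_of_nonneg_ae
      (Filter.Eventually.of_forall fun f => mul_self_nonneg _) (hint x x)]
    have hopen : IsOpen (Function.support (fun f : D => f x * f x) ∩ Metric.ball 0 r) :=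
      ((hcont x x).isOpen_support).inter Metric.isOpen_ball
    refine lt_of_lt_of_le (hopen.measure_pos μ ?_)
      (measure_mono (Set.inter_subset_inter_right _ hball))
    obtain ⟨g, -, hg⟩ := exists_dual_vector ℝ x (norm_ne_zero_iff.2 hx)
    have hgx : g x ≠ 0 := by rw [hg]; simpa using hx
    refine ⟨(r / (2 * (‖g‖ + 1))) • g, ?_, ?_⟩
    · have : r / (2 * (‖g‖ + 1)) ≠ 0 := by positivity
      simp [hgx, hr.ne']
      positivity
    · rw [mem_ball_zero_iff, norm_smul, Real.norm_of_nonneg (by positivity)]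
      rw [div_mul_eq_mul_div, div_lt_iff₀ (by positivity)]
      nlinarith [norm_nonneg g]
  · let L : D ≃L[ℝ] D := ((T.toContinuousLinearEquiv).arrowCongr
      (ContinuousLinearEquiv.refl ℝ ℝ)).symm
    have hL : ∀ f : D, ∀ x, L f x = f (T x) := fun f x => rfl
    have hpre : L ⁻¹' E = E := by
      ext f
      simp only [E, Set.mem_preimage, Set.mem_ofPred_eq, hL]
      refine ⟨fun h w hw => ?_, fun h w hw => h _ ((hT w).2 hw)⟩
      have := h (T.symm w) ((hT _).1 (by simpa using hw))
      simpa using this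
    have hdet : LinearMap.det (L : D →ₗ[ℝ] D) ≠ 0 := (LinearEquiv.isUnit_det' L.toLinearEquiv).ne_zero
    have h1 := Measure.addHaar_preimage_linearMap μ hdet E
    have hpos : μ E ≠ 0 := ((Metric.measure_ball_pos μ _ hr).trans_le (measure_mono hball)).ne'
    -- The scaling factor fixes `μ E`, which is neither zero nor infinite, so it equals one.
    have hscale : ENNReal.ofReal |(LinearMap.det (L : D →ₗ[ℝ] D))⁻¹| = 1 := by
      have h2 : μ E = ENNReal.ofReal |(LinearMap.det (L : D →ₗ[ℝ] D))⁻¹| * μ E := by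
        rw [← h1]
        exact congrArg μ hpre.symm
      exact ((ENNReal.mul_eq_right hpos hEcomp.measure_lt_top.ne).1 h2.symm)
    have hmp : MeasurePreserving L μ μ := by
      refine ⟨L.continuous.measurable, ?_⟩
      have := Measure.map_linearMap_addHaar_eq_smul_addHaar μ hdet
      rw [hscale, one_smul] at this
      exact this
    have := hmp.setIntegral_preimage_emb L.toHomeomorph.measurableEmbedding
      (fun f : D => f x * f y) E
    rw [hpre] at this
    rw [hB, hB, ← this]
    rfl

/-! ### States, frames and reversible transformations. -/

namespace GPT

variable {A : Type*} [NormedAddCommGroup A] [NormedSpace ℝ A] {S : GPT A}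

theorem states_subset_cone : S.states ⊆ S.cone := fun w hw => ⟨1, zero_le_one, w, hw, (one_smul ℝ w).symm⟩

theorem pureStates_subset_states : S.pureStates ⊆ S.states := extremePoints_subset

theorem pure_mem_cone {w : A} (hw : w ∈ S.pureStates) : w ∈ S.cone :=
  states_subset_cone (pureStates_subset_states hw)

theorem add_mem_cone {x y : A} (hx : x ∈ S.cone) (hy : y ∈ S.cone) : x + y ∈ S.cone :=
  S.isCone.add_mem x hx y hy

theorem smul_mem_cone {r : ℝ} (hr : 0 ≤ r) {x : A} (hx : x ∈ S.cone) : r • x ∈ S.cone :=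
  S.isCone.smul_mem r hr x hx

variable (S) in
theorem states_nonempty : S.states.Nonempty := by
  obtain ⟨_, _, _, w, hw, _⟩ := S.isCone.nonempty
  exact ⟨w, hw⟩

variable (S) in
theorem zero_mem_cone : (0 : A) ∈ S.cone := by
  obtain ⟨w, hw⟩ := S.states_nonempty
  exact ⟨0, le_rfl, w, hw, (zero_smul ℝ w).symm⟩

theorem sum_mem_cone {ι : Type*} (s : Finset ι) {f : ι → A} (h : ∀ i ∈ s, f i ∈ S.cone) :
    ∑ i ∈ s, f i ∈ S.cone :=
  Finset.sum_induction f (· ∈ S.cone) (fun _ _ => add_mem_cone) S.zero_mem_cone h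

theorem unit_state {w : A} (hw : w ∈ S.states) : S.unit w = 1 :=
  (S.unit_eq_one_iff w (states_subset_cone hw)).2 hw

theorem unit_pure {w : A} (hw : w ∈ S.pureStates) : S.unit w = 1 :=
  unit_state (pureStates_subset_states hw)

theorem unit_nonneg {x : A} (hx : x ∈ S.cone) : 0 ≤ S.unit x := by
  by_cases h : x = 0
  · simp [h]
  · exact (S.unit_pos x hx h).le

theorem span_states (S : GPT A) : Submodule.span ℝ S.states = ⊤ := by
  rw [← S.generating]
  refine le_antisymm (Submodule.span_mono states_subset_cone) (Submodule.span_le.2 ?_)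
  rintro _ ⟨r, -, w, hw, rfl⟩
  exact Submodule.smul_mem _ _ (Submodule.subset_span hw)

theorem functional_ext_cone {f g : Module.Dual ℝ A} (h : ∀ x ∈ S.cone, f x = g x) : f = g :=
  LinearMap.ext_on S.generating h

/-- Every vector is a difference of two elements of the cone. -/
theorem exists_sub_of_cone (S : GPT A) (x : A) : ∃ a ∈ S.cone, ∃ b ∈ S.cone, x = a - b := by
  have hx : x ∈ Submodule.span ℝ S.cone := by
    have := S.generating
    rw [show nonnegMultiples S.states = S.cone from rfl] at this
    rw [this]; trivial
  induction hx using Submodule.span_induction with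
  | mem x hx => exact ⟨x, hx, 0, S.zero_mem_cone, by simp⟩
  | zero => exact ⟨0, S.zero_mem_cone, 0, S.zero_mem_cone, by simp⟩
  | add x y _ _ hx hy =>
    obtain ⟨a, ha, b, hb, rfl⟩ := hx
    obtain ⟨c, hc, d, hd, rfl⟩ := hy
    exact ⟨a + c, add_mem_cone ha hc, b + d, add_mem_cone hb hd, by abel⟩
  | smul r x _ hx =>
    obtain ⟨a, ha, b, hb, rfl⟩ := hx
    rcases le_total 0 r with hr | hr
    · exact ⟨r • a, smul_mem_cone hr ha, r • b, smul_mem_cone hr hb, smul_sub _ _ _⟩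
    · refine ⟨(-r) • b, smul_mem_cone (by linarith) hb, (-r) • a, smul_mem_cone (by linarith) ha, ?_⟩
      module

theorem PerfectlyDistinguishable.comp {m n : ℕ} {w : Fin n → A} (h : S.PerfectlyDistinguishable w)
    {f : Fin m → Fin n} (hf : Function.Injective f) : S.PerfectlyDistinguishable (w ∘ f) := by
  obtain ⟨hw, e, he, hsum, hdelta⟩ := h
  refine ⟨fun k => hw _, e ∘ f, fun j => he _, fun x hx => ?_, fun j k => ?_⟩
  · refine le_trans ?_ (hsum x hx)
    simp only [Function.comp_apply]
    rw [← Finset.sum_image (g := f) (s := Finset.univ) (f := fun i => e i x) hf.injOn]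
    exact Finset.sum_le_sum_of_subset_of_nonneg (Finset.subset_univ _)
      fun i _ _ => (he i x hx).1
  · simp only [Function.comp_apply, hdelta, hf.eq_iff]

theorem IsFrame.comp {m n : ℕ} {w : Fin n → A} (h : S.IsFrame w)
    {f : Fin m → Fin n} (hf : Function.Injective f) : S.IsFrame (w ∘ f) :=
  ⟨fun _ => h.1 _, h.2.comp hf⟩

theorem isFrame_of_pure {w : A} (hw : w ∈ S.pureStates) : S.IsFrame (fun _ : Fin 1 => w) := by
  refine ⟨fun _ => hw, fun _ => pureStates_subset_states hw, fun _ => S.unit,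
    fun _ x hx => ⟨unit_nonneg hx, le_rfl⟩, fun x _ => by simp, fun j k => ?_⟩
  rw [if_pos (Subsingleton.elim _ _), unit_pure hw]

theorem isFrame_pair {v w : A} (hv : v ∈ S.pureStates) (hw : w ∈ S.pureStates)
    {e : Module.Dual ℝ A} (he : S.IsEffect e) (hev : e v = 1) (hew : e w = 0) :
    S.IsFrame ![v, w] := by
  have hp : ∀ k, ![v, w] k ∈ S.pureStates := by
    intro k; fin_cases k <;> assumption
  refine ⟨hp, fun k => pureStates_subset_states (hp k), ![e, S.unit - e], ?_, ?_, ?_⟩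
  · intro j x hx
    have := he x hx
    fin_cases j
    · exact this
    · simp [this.1, this.2]
  · intro x _
    simp [Fin.sum_univ_two]
  · intro j k
    fin_cases j <;> fin_cases k <;> simp [hev, hew, unit_pure hv, unit_pure hw]

/-- Every element of the cone is a positive combination of a frame. -/
theorem exists_frame_decomposition (hdec : S.ClassicalDecomposability) {x : A} (hx : x ∈ S.cone) :
    ∃ (k : ℕ) (w : Fin k → A) (c : Fin k → ℝ), S.IsFrame w ∧ (∀ i, 0 < c i) ∧
      x = ∑ i, c i • w i := by
  obtain ⟨r, hr, y, hy, rfl⟩ := hx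
  obtain ⟨n, p, v, hp, hv, rfl⟩ := hdec y hy
  -- Zero weights are dropped to get strictly positive coefficients; for `r = 0` this leaves the
  -- empty frame.
  let s : Finset (Fin n) := Finset.univ.filter fun i => 0 < r * p i
  let g := s.equivFin.symm
  refine ⟨s.card, fun i => v (g i), fun i => r * p (g i),
    hv.comp (f := fun i => (g i : Fin n)) (Subtype.val_injective.comp g.injective),
    fun i => (Finset.mem_filter.1 (g i).2).2, ?_⟩
  rw [g.sum_comp (fun i : s => (r * p i) • v i), Finset.sum_coe_sort s (fun i => (r * p i) • v i),
    Finset.smul_sum, Finset.sum_filter]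
  refine Finset.sum_congr rfl fun i _ => ?_
  split_ifs with h
  · rw [smul_smul]
  · have : r * p i = 0 := le_antisymm (not_lt.1 h) (mul_nonneg hr (hp.1 i))
    rw [smul_smul, this, zero_smul]

theorem functional_nonneg_of_pure (hdec : S.ClassicalDecomposability) {f : Module.Dual ℝ A}
    (h : ∀ w ∈ S.pureStates, 0 ≤ f w) {x : A} (hx : x ∈ S.cone) : 0 ≤ f x := by
  obtain ⟨k, w, c, hw, hc, rfl⟩ := exists_frame_decomposition hdec hx
  rw [map_sum]
  exact Finset.sum_nonneg fun i _ => by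
    rw [map_smul]; exact mul_nonneg (hc i).le (h _ (hw.1 i))

theorem functional_ext_pure (hdec : S.ClassicalDecomposability) {f g : Module.Dual ℝ A}
    (h : ∀ w ∈ S.pureStates, f w = g w) : f = g := by
  refine functional_ext_cone (S := S) fun x hx => ?_
  obtain ⟨k, w, c, hw, hc, rfl⟩ := exists_frame_decomposition hdec hx
  simp only [map_sum, map_smul]
  exact Finset.sum_congr rfl fun i _ => by rw [h _ (hw.1 i)]

section Reversible

variable {T : A ≃ₗ[ℝ] A}

/-- Neither `T` nor its inverse increases the normalization, so both preserve it. -/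
theorem reversible_unit (hT : T ∈ S.reversible) (x : A) : S.unit (T x) = S.unit x := by
  have : S.unit.comp (T : A →ₗ[ℝ] A) = S.unit := by
    refine functional_ext_cone (S := S) fun x hx => le_antisymm (S.reversible_unit_le T hT x hx) ?_
    have := S.reversible_unit_le _ (S.reversible.inv_mem hT) _ (S.reversible_pos T hT x hx)
    have h : (T⁻¹) (T x) = x := T.symm_apply_apply x
    rwa [h] at this
  exact LinearMap.congr_fun this x

theorem reversible_mem_states (hT : T ∈ S.reversible) {w : A} (hw : w ∈ S.states) :
    T w ∈ S.states :=
  (S.unit_eq_one_iff _ (S.reversible_pos T hT w (states_subset_cone hw))).1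
    (by rw [reversible_unit hT, unit_state hw])

theorem reversible_mem_states_iff (hT : T ∈ S.reversible) (w : A) :
    T w ∈ S.states ↔ w ∈ S.states := by
  refine ⟨fun h => ?_, reversible_mem_states hT⟩
  have := reversible_mem_states (S.reversible.inv_mem hT) h
  have h' : (T⁻¹) (T w) = w := T.symm_apply_apply w
  rwa [h'] at this

theorem reversible_mem_pureStates (hT : T ∈ S.reversible) {w : A} (hw : w ∈ S.pureStates) :
    T w ∈ S.pureStates := by
  have him : T '' S.states = S.states := by
    ext x
    refine ⟨?_, fun hx => ⟨T.symm x, ?_, T.apply_symm_apply x⟩⟩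
    · rintro ⟨y, hy, rfl⟩; exact reversible_mem_states hT hy
    · rwa [← reversible_mem_states_iff hT, T.apply_symm_apply]
  have := image_extremePoints T S.states
  rw [him] at this
  exact this.subset (Set.mem_image_of_mem T hw)

theorem reversible_mem_cone (hT : T ∈ S.reversible) {x : A} (hx : x ∈ S.cone) : T x ∈ S.cone :=
  S.reversible_pos T hT x hx

end Reversible

/-- An invariant vector which is the sum of a frame. -/
theorem exists_invariant_frame_sum [FiniteDimensional ℝ A] (hdec : S.ClassicalDecomposability)
    (hsym : S.StrongSymmetry) {B : A →ₗ[ℝ] A →ₗ[ℝ] ℝ} (hBs : ∀ x y, B x y = B y x)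
    (hBp : ∀ x, x ≠ 0 → 0 < B x x)
    (hBi : ∀ T ∈ S.reversible, ∀ x y, B (T x) (T y) = B x y) :
    ∃ (n : ℕ) (w : Fin n → A), 0 < n ∧ S.IsFrame w ∧
      ∀ T ∈ S.reversible, T (∑ i, w i) = ∑ i, w i := by
  have hcont : Continuous fun x : A => B x x := by
    have h1 : Continuous fun x : A => LinearMap.toContinuousLinearMap (B x) :=
      (LinearMap.toContinuousLinearMap.toLinearMap.comp B).continuous_of_finiteDimensional
    exact h1.clm_apply continuous_id
  obtain ⟨μ, hμ, hmin⟩ := S.isCompact_states.exists_isMinOn S.states_nonempty hcont.continuousOn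
  -- Strict convexity: if `T μ ≠ μ`, two states of equal minimal norm would have a midpoint of
  -- smaller norm.
  have hinv : ∀ T ∈ S.reversible, T μ = μ := by
    intro T hT
    by_contra hne
    have h1 := hBp (T μ - μ) (sub_ne_zero.2 hne)
    have h2 : ((1 : ℝ) / 2) • T μ + ((1 : ℝ) / 2) • μ ∈ S.states :=
      S.convex_states (reversible_mem_states hT hμ) hμ (by norm_num) (by norm_num) (by norm_num)
    have h3 : B μ μ ≤ _ := hmin h2
    have h4 := hBi T hT μ μ
    have h5 := hBs (T μ) μ
    simp only [map_add, map_sub, map_smul, LinearMap.add_apply, LinearMap.sub_apply,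
      LinearMap.smul_apply, smul_eq_mul] at h1 h3
    linarith
  obtain ⟨n, w, c, hw, hc, hsum⟩ := exists_frame_decomposition hdec (states_subset_cone hμ)
  have hn : 0 < n := by
    rcases Nat.eq_zero_or_pos n with rfl | h
    · have := unit_state hμ
      simp [hsum] at this
    · exact h
  -- Transposing two frame elements is realized by a reversible map, which fixes `μ`.
  have hceq : ∀ i j, c i = c j := by
    intro i j
    obtain ⟨T, hT, hTw⟩ := hsym n w (w ∘ Equiv.swap i j) hw (hw.comp (Equiv.injective _))
    obtain ⟨-, -, e, -, -, hdelta⟩ := hw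
    have h1 : e i (T μ) = c j := by
      rw [hsum]
      simp only [map_sum, map_smul, hTw, Function.comp_apply, hdelta]
      rw [Finset.sum_eq_single j]
      · simp
      · intro b _ hb
        rw [if_neg, smul_zero]
        intro h
        exact hb ((Equiv.swap i j).injective (h.symm.trans (Equiv.swap_apply_right i j).symm))
      · simp
    have h2 : e i μ = c i := by
      rw [hsum]
      simp [hdelta]
    rw [← h1, ← h2, hinv T hT]
  have hμsum : ∑ i, w i = (c ⟨0, hn⟩)⁻¹ • μ := by
    rw [hsum, Finset.smul_sum]
    refine Finset.sum_congr rfl fun i _ => ?_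
    rw [hceq i ⟨0, hn⟩, smul_smul, inv_mul_cancel₀ (hc _).ne', one_smul]
  refine ⟨n, w, hn, hw, fun T hT => ?_⟩
  rw [hμsum, map_smul, hinv T hT]

end GPT

/-! ### Construction of the self-dualizing form. -/

namespace GPT

variable {A : Type*} [NormedAddCommGroup A] [NormedSpace ℝ A] {S : GPT A}

/-- A symmetric positive definite form for which the cone of states is self-dual, the vector `U`
represents the order unit, and frames are orthonormal with sum below the order unit. -/
structure IsSelfDualForm (S : GPT A) (B : A →ₗ[ℝ] A →ₗ[ℝ] ℝ) (U : A) : Prop where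
  symm : ∀ x y, B x y = B y x
  definite : ∀ x, B x x = 0 → x = 0
  nonneg : ∀ x ∈ S.cone, ∀ y ∈ S.cone, 0 ≤ B x y
  mem_cone : ∀ x, (∀ y ∈ S.cone, 0 ≤ B x y) → x ∈ S.cone
  unit_eq : B U = S.unit
  frame_apply : ∀ (k : ℕ) (w : Fin k → A), S.IsFrame w → ∀ i j, B (w i) (w j) = if i = j then 1 else 0
  frame_sum_le : ∀ (k : ℕ) (w : Fin k → A), S.IsFrame w → ∀ y ∈ S.cone,
    ∑ i, B (w i) y ≤ S.unit y

section Construction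

variable {n : ℕ} {w : Fin n → A}

/-- A frame with invariant sum is maximal: every frame is obtained from an initial segment of it
by a reversible transformation. -/
theorem exists_reversible_castLE (hsym : S.StrongSymmetry)
    (hn : 0 < n) (hw : S.IsFrame w) (hU : ∀ T ∈ S.reversible, T (∑ i, w i) = ∑ i, w i)
    {m : ℕ} {v : Fin m → A} (hv : S.IsFrame v) :
    ∃ h : m ≤ n, ∃ T ∈ S.reversible, ∀ i, T (w (Fin.castLE h i)) = v i := by
  -- Any pure state is a summand of `U = T U` for a suitable `T`, and all summands are in the cone.
  have hzero : ∀ e : Module.Dual ℝ A, (∀ x ∈ S.cone, 0 ≤ e x) → e (∑ i, w i) = 0 →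
      ∀ x ∈ S.pureStates, e x = 0 := by
    intro e he h0 x hx
    obtain ⟨T, hT, hTx⟩ := hsym 1 (fun _ => w ⟨0, hn⟩) (fun _ => x) (isFrame_of_pure (hw.1 _))
      (isFrame_of_pure hx)
    rw [← hU T hT, map_sum, map_sum, Finset.sum_eq_zero_iff_of_nonneg] at h0
    · rw [← hTx 0]; exact h0 _ (Finset.mem_univ _)
    · exact fun i _ => he _ (reversible_mem_cone hT (pure_mem_cone (hw.1 i)))
  have hmn : m ≤ n := by
    by_contra! h
    have hv' : S.IsFrame (v ∘ Fin.castLE h.le) := hv.comp (Fin.castLE_injective _)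
    obtain ⟨T, hT, hTw⟩ := hsym n w _ hw hv'
    obtain ⟨hp, -, e, he, -, hdelta⟩ := hv
    -- The first `n` members of `v` are an image of `w`, so they also sum to `U`, and the effect
    -- detecting the next member kills them all.
    have h1 : e ⟨n, h⟩ (∑ i, w i) = 0 := by
      rw [← hU T hT, map_sum, map_sum]
      refine Finset.sum_eq_zero fun i _ => ?_
      rw [hTw, Function.comp_apply, hdelta, if_neg]
      intro h2
      have := congrArg Fin.val h2
      have h3 := i.2
      simp at this
      omega
    have h2 := hzero _ (fun x hx => (he _ x hx).1) h1 _ (hp ⟨n, h⟩)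
    rw [hdelta, if_pos rfl] at h2
    exact one_ne_zero h2
  exact ⟨hmn, hsym m _ v (hw.comp (f := Fin.castLE hmn) (Fin.castLE_injective hmn)) hv⟩

/-- Spectral decomposition of arbitrary vectors. -/
theorem exists_reversible_decomposition (hdec : S.ClassicalDecomposability)
    (hsym : S.StrongSymmetry) (hn : 0 < n) (hw : S.IsFrame w)
    (hU : ∀ T ∈ S.reversible, T (∑ i, w i) = ∑ i, w i) (x : A) :
    ∃ T ∈ S.reversible, ∃ c : Fin n → ℝ, x = ∑ i, c i • T (w i) := by
  set U := ∑ i, w i with hUdef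
  have hpure : ∀ y ∈ S.pureStates, U - y ∈ S.cone := by
    intro y hy
    obtain ⟨T, hT, hTy⟩ := hsym 1 (fun _ => w ⟨0, hn⟩) (fun _ => y) (isFrame_of_pure (hw.1 _))
      (isFrame_of_pure hy)
    rw [← hU T hT, ← hTy 0, ← map_sub, hUdef, ← Finset.sum_erase_add _ _ (Finset.mem_univ ⟨0, hn⟩),
      add_sub_cancel_right]
    exact reversible_mem_cone hT (sum_mem_cone _ fun i _ => pure_mem_cone (hw.1 i))
  have hcone : ∀ y ∈ S.cone, ∃ t : ℝ, t • U - y ∈ S.cone := by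
    intro y hy
    obtain ⟨k, v, c, hv, hc, rfl⟩ := exists_frame_decomposition hdec hy
    refine ⟨∑ i, c i, ?_⟩
    rw [Finset.sum_smul, ← Finset.sum_sub_distrib]
    refine sum_mem_cone _ fun i _ => ?_
    rw [← smul_sub]
    exact smul_mem_cone (hc i).le (hpure _ (hv.1 i))
  obtain ⟨a, ha, b, hb, rfl⟩ := S.exists_sub_of_cone x
  obtain ⟨t, ht⟩ := hcone b hb
  obtain ⟨k, v, c, hv, hc, heq⟩ := exists_frame_decomposition hdec (add_mem_cone ha ht)
  obtain ⟨hk, T, hT, hTv⟩ := exists_reversible_castLE hsym hn hw hU hv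
  -- The coefficients of `a + (t • U - b)` are padded with zeros; removing `t • U = ∑ t • T (w i)`
  -- shifts each of them by `t`.
  refine ⟨T, hT, fun i : Fin n => (if h : (i : ℕ) < k then c ⟨i, h⟩ else 0) - t, ?_⟩
  have h1 : ∑ i, c i • v i = ∑ i : Fin n, (if h : (i : ℕ) < k then c ⟨i, h⟩ else 0) • T (w i) := by
    rw [← Finset.sum_subset (Finset.subset_univ (Finset.univ.image (Fin.castLE hk))),
      Finset.sum_image (Fin.castLE_injective hk).injOn]
    · refine Finset.sum_congr rfl fun i _ => ?_
      simp [hTv]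
    · intro i _ hi
      rw [dif_neg, zero_smul]
      intro h
      exact hi (Finset.mem_image.2 ⟨⟨i, h⟩, Finset.mem_univ _, rfl⟩)
  have h2 : a - b = ∑ i, c i • v i - t • U := by rw [← heq]; abel
  simp only [sub_smul, Finset.sum_sub_distrib]
  rw [h2, h1, ← Finset.smul_sum, ← map_sum, hU T hT]

/-- An invariant symmetric form for which the frame `w` is orthonormal. -/
theorem exists_invariant_orthonormal_form (hsym : S.StrongSymmetry) (hn : 0 < n)
    (hw : S.IsFrame w) {B₀ : A →ₗ[ℝ] A →ₗ[ℝ] ℝ} (hBs : ∀ x y, B₀ x y = B₀ y x)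
    (hBp : ∀ x, x ≠ 0 → 0 < B₀ x x)
    (hBi : ∀ T ∈ S.reversible, ∀ x y, B₀ (T x) (T y) = B₀ x y) :
    ∃ B : A →ₗ[ℝ] A →ₗ[ℝ] ℝ, (∀ x y, B x y = B y x) ∧
      (∀ T ∈ S.reversible, ∀ x y, B (T x) (T y) = B x y) ∧
      ∀ i j, B (w i) (w j) = if i = j then 1 else 0 := by
  have hcomb : ∀ α β : ℝ, ∃ B : A →ₗ[ℝ] A →ₗ[ℝ] ℝ,
      ∀ x y, B x y = α * B₀ x y + β * (S.unit x * S.unit y) := fun α β =>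
    ⟨α • B₀ + β • (LinearMap.mul ℝ ℝ).compl₁₂ S.unit S.unit, fun x y => by simp⟩
  -- By symmetry `B₀` takes one value on the diagonal of the frame and one off it, while `u ⊗ u` is
  -- constantly `1`; two parameters suffice.
  suffices h : ∃ α β : ℝ, ∀ i j, α * B₀ (w i) (w j) + β = if i = j then 1 else 0 by
    obtain ⟨α, β, h⟩ := h
    obtain ⟨B, hB⟩ := hcomb α β
    refine ⟨B, fun x y => by rw [hB, hB, hBs, mul_comm (S.unit x)], fun T hT x y => ?_,
      fun i j => ?_⟩
    · rw [hB, hB, hBi T hT, reversible_unit hT, reversible_unit hT]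
    · rw [hB, unit_pure (hw.1 i), unit_pure (hw.1 j), ← h]; ring
  have hdiag : ∀ i j, B₀ (w i) (w i) = B₀ (w j) (w j) := by
    intro i j
    obtain ⟨T, hT, hTw⟩ := hsym 1 (fun _ => w i) (fun _ => w j) (isFrame_of_pure (hw.1 _))
      (isFrame_of_pure (hw.1 _))
    rw [← hTw 0, hBi T hT]
  have hoff : ∀ i j k l, i ≠ j → k ≠ l → B₀ (w i) (w j) = B₀ (w k) (w l) := by
    intro i j k l hij hkl
    have hinj : ∀ {i j : Fin n}, i ≠ j → Function.Injective ![i, j] := fun hij => by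
      intro a b; fin_cases a <;> fin_cases b <;> simp [hij, hij.symm]
    obtain ⟨T, hT, hTw⟩ := hsym 2 _ _ (hw.comp (hinj hij)) (hw.comp (hinj hkl))
    have h0 : T (w i) = w k := hTw 0
    have h1 : T (w j) = w l := hTw 1
    rw [← h0, ← h1, hBi T hT]
  rcases Nat.lt_or_ge 1 n with h1 | h1
  · set i₀ : Fin n := ⟨0, hn⟩
    set i₁ : Fin n := ⟨1, h1⟩
    have hne : i₀ ≠ i₁ := by simp [i₀, i₁, Fin.ext_iff]
    have hwne : w i₀ - w i₁ ≠ 0 := by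
      intro h
      -- Distinguishability makes `w i₀ - w i₁` nonzero; half its squared norm is the gap between
      -- the diagonal and off-diagonal values, by which one must divide.
      obtain ⟨-, -, e, -, -, hdelta⟩ := hw
      have := congrArg (e i₀) h
      simp [hdelta, hne] at this
    have hpos := hBp _ hwne
    simp only [map_sub, LinearMap.sub_apply] at hpos
    rw [hBs (w i₁) (w i₀), hdiag i₁ i₀] at hpos
    have hd : B₀ (w i₀) (w i₀) - B₀ (w i₀) (w i₁) ≠ 0 := by
      intro h; linarith
    refine ⟨(B₀ (w i₀) (w i₀) - B₀ (w i₀) (w i₁))⁻¹,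
      -((B₀ (w i₀) (w i₀) - B₀ (w i₀) (w i₁))⁻¹ * B₀ (w i₀) (w i₁)), fun i j => ?_⟩
    split_ifs with hij
    · subst hij
      rw [hdiag i i₀, ← sub_eq_add_neg, ← mul_sub, inv_mul_cancel₀ hd]
    · rw [hoff i j i₀ i₁ hij hne, ← sub_eq_add_neg, sub_self]
  -- For `n = 1` there is no off-diagonal value, and `u ⊗ u` alone is normalized.
  · refine ⟨0, 1, fun i j => ?_⟩
    rw [if_pos (by ext; omega)]
    ring

theorem isSelfDualForm_of_invariant [FiniteDimensional ℝ A] (hdec : S.ClassicalDecomposability)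
    (hsym : S.StrongSymmetry) (hn : 0 < n) (hw : S.IsFrame w)
    (hU : ∀ T ∈ S.reversible, T (∑ i, w i) = ∑ i, w i)
    {B : A →ₗ[ℝ] A →ₗ[ℝ] ℝ} (hBs : ∀ x y, B x y = B y x)
    (hBi : ∀ T ∈ S.reversible, ∀ x y, B (T x) (T y) = B x y)
    (hBw : ∀ i j, B (w i) (w j) = if i = j then 1 else 0) :
    S.IsSelfDualForm B (∑ i, w i) := by
  have hspec := exists_reversible_decomposition hdec hsym hn hw hU
  have hBT : ∀ T ∈ S.reversible, ∀ (c d : Fin n → ℝ),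
      B (∑ i, c i • T (w i)) (∑ i, d i • T (w i)) = ∑ i, c i * d i := by
    intro T hT c d
    simp [hBi T hT, hBw, mul_comm]
  have hunit : B (∑ i, w i) = S.unit := by
    refine functional_ext_pure hdec fun y hy => ?_
    obtain ⟨T, hT, hTy⟩ := hsym 1 (fun _ => w ⟨0, hn⟩) (fun _ => y) (isFrame_of_pure (hw.1 _))
      (isFrame_of_pure hy)
    rw [← hU T hT, ← hTy 0, hBi T hT, reversible_unit hT, unit_pure (hw.1 _)]
    simp [hBw]
  have hframe : ∀ (k : ℕ) (v : Fin k → A), S.IsFrame v → ∀ i j,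
      B (v i) (v j) = if i = j then 1 else 0 := by
    intro k v hv i j
    obtain ⟨hk, T, hT, hTv⟩ := exists_reversible_castLE hsym hn hw hU hv
    rw [← hTv, ← hTv, hBi T hT, hBw]
    simp [(Fin.castLE_injective hk).eq_iff]
  have hself : ∀ x, 0 ≤ B x x := by
    intro x
    obtain ⟨T, hT, c, rfl⟩ := hspec x
    rw [hBT T hT]
    exact Finset.sum_nonneg fun i _ => mul_self_nonneg _
  have hle1 : ∀ x ∈ S.states, B x x ≤ 1 := by
    intro x hx
    obtain ⟨k, v, c, hv, hc, heq⟩ := exists_frame_decomposition hdec (states_subset_cone hx)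
    have h1 : ∑ i, c i = 1 := by
      have := unit_state hx
      rw [heq, map_sum] at this
      simpa [unit_pure (hv.1 _)] using this
    have h2 : B x x = ∑ i, c i * c i := by
      rw [heq]
      simp [hframe k v hv]
    rw [h2, ← h1]
    refine Finset.sum_le_sum fun i _ => ?_
    have : c i ≤ 1 := h1 ▸ Finset.single_le_sum (fun j _ => (hc j).le) (Finset.mem_univ i)
    nlinarith [hc i]
  -- The heart of self-duality. If `B x` were negative somewhere, a pure minimizer `y` could be
  -- perfectly distinguished from `x`, so orthonormality of frames would give `B x y = 0`.
  have hpure : ∀ x ∈ S.pureStates, ∀ y ∈ S.states, 0 ≤ B x y := by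
    intro x hx
    have hxx : B x x = 1 := by
      have := hframe 1 _ (isFrame_of_pure hx) 0 0
      simpa using this
    have hle : ∀ y ∈ S.states, B x y ≤ 1 := by
      intro y hy
      have h1 := hself (x - y)
      have h2 := hle1 y hy
      simp only [map_sub, LinearMap.sub_apply] at h1
      rw [hBs y x] at h1
      linarith
    by_contra! hneg
    obtain ⟨y₀, hy₀, hneg⟩ := hneg
    -- the minimum over the states is attained at a pure state
    have hmin : ∃ y ∈ S.pureStates, B x y < 0 ∧ ∀ z ∈ S.states, B x y ≤ B x z := by
      obtain ⟨y₁, hy₁, hmin⟩ := S.isCompact_states.exists_isMinOn S.states_nonempty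
        (B x).continuous_of_finiteDimensional.continuousOn
      obtain ⟨k, v, c, hv, hc, heq⟩ := exists_frame_decomposition hdec (states_subset_cone hy₁)
      have h1 : ∑ i, c i = 1 := by
        have := unit_state hy₁
        rw [heq, map_sum] at this
        simpa [unit_pure (hv.1 _)] using this
      have h2 : ∑ i, c i * B x (v i) = ∑ i, c i * B x y₁ := by
        rw [← Finset.sum_mul, h1, one_mul, heq]
        simp
      obtain ⟨i, -, hi⟩ := Finset.exists_le_of_sum_le (by
        rw [Finset.univ_nonempty_iff]
        by_contra hne
        rw [not_nonempty_iff] at hne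
        simp at h1) h2.le
      have hi' : B x (v i) ≤ B x y₁ := le_of_mul_le_mul_left hi (hc i)
      exact ⟨v i, hv.1 i, (hi'.trans (hmin hy₀)).trans_lt hneg, fun z hz => hi'.trans (hmin hz)⟩
    obtain ⟨y, hy, hyneg, hymin⟩ := hmin
    set m := B x y
    -- On states `B x` ranges between its minimum `m` at `y` and its maximum `1` at `x`; the affine
    -- rescaling sends these to `0` and `1`.
    have he : S.IsEffect ((1 - m)⁻¹ • (B x - m • S.unit)) := by
      have h0 : (0 : ℝ) < 1 - m := by linarith
      rintro _ ⟨r, hr, z, hz, rfl⟩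
      have h1 := hymin z hz
      have h2 := hle z hz
      simp only [LinearMap.smul_apply, LinearMap.sub_apply, map_smul, smul_eq_mul, unit_state hz,
        mul_one]
      constructor
      · have : 0 ≤ B x z - m := by linarith
        positivity
      · refine mul_le_of_le_one_right hr ?_
        rw [inv_mul_le_iff₀ h0]
        linarith
    have hfr := isFrame_pair hx hy he
      (by
        have : (1 - m) ≠ 0 := by linarith
        simp [hxx, unit_pure hx, this])
      (by simp [m, unit_pure hy])
    have := hframe 2 _ hfr 0 1
    simp at this
    exact hyneg.ne this
  have hnonneg : ∀ x ∈ S.cone, ∀ y ∈ S.cone, 0 ≤ B x y := by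
    intro x hx y hy
    rw [hBs]
    refine functional_nonneg_of_pure hdec (f := B y) (fun w hw => ?_) hx
    obtain ⟨r, hr, z, hz, rfl⟩ := hy
    rw [hBs, map_smul]
    exact mul_nonneg hr (hpure w hw z hz)
  refine ⟨hBs, fun x hx => ?_, hnonneg, fun x hx => ?_, hunit, hframe, fun k v hv y hy => ?_⟩
  · obtain ⟨T, hT, c, rfl⟩ := hspec x
    rw [hBT T hT, Finset.sum_eq_zero_iff_of_nonneg fun i _ => mul_self_nonneg _] at hx
    refine Finset.sum_eq_zero fun i hi => ?_
    rw [mul_self_eq_zero.1 (hx i hi), zero_smul]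
  -- The coefficients of `x` are its products with the orthonormal vectors `T (w i)`, which lie in
  -- the cone.
  · obtain ⟨T, hT, c, rfl⟩ := hspec x
    refine sum_mem_cone _ fun i _ => smul_mem_cone ?_ (reversible_mem_cone hT (pure_mem_cone (hw.1 i)))
    have := hx _ (reversible_mem_cone hT (pure_mem_cone (hw.1 i)))
    simpa [hBi T hT, hBw] using this
  · obtain ⟨hk, T, hT, hTv⟩ := exists_reversible_castLE hsym hn hw hU hv
    rw [← hunit, ← hU T hT, map_sum, map_sum, LinearMap.sum_apply]
    simp only [← hTv]
    rw [← Finset.sum_image (g := Fin.castLE hk) (s := Finset.univ)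
      (f := fun i => B (T (w i)) y) (Fin.castLE_injective hk).injOn]
    exact Finset.sum_le_sum_of_subset_of_nonneg (Finset.subset_univ _) fun i _ _ =>
      hnonneg _ (reversible_mem_cone hT (pure_mem_cone (hw.1 i))) _ hy

end Construction

theorem exists_isSelfDualForm [FiniteDimensional ℝ A] (hdec : S.ClassicalDecomposability)
    (hsym : S.StrongSymmetry) : ∃ B U, S.IsSelfDualForm B U := by
  obtain ⟨B₀, hs, hp, hi⟩ := exists_invariant_posDef_form S.states S.isCompact_states.isBounded
    S.span_states
  have hi' : ∀ T ∈ S.reversible, ∀ x y, B₀ (T x) (T y) = B₀ x y := fun T hT =>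
    hi T (reversible_mem_states_iff hT)
  obtain ⟨n, w, hn, hw, hU⟩ := exists_invariant_frame_sum hdec hsym hs hp hi'
  obtain ⟨B, hBs, hBi, hBw⟩ := exists_invariant_orthonormal_form hsym hn hw hs hp hi'
  exact ⟨B, _, isSelfDualForm_of_invariant hdec hsym hn hw hU hBs hBi hBw⟩

end GPT

namespace GPT

variable {A : Type*} [NormedAddCommGroup A] [NormedSpace ℝ A] {S : GPT A}

/-! Faces of the cone of states. -/

section Faces

variable {F H : Set A}

theorem face_subset (hF : IsFace S.cone F) : F ⊆ S.cone := hF.isExtreme.subset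

theorem face_zero_mem (hF : IsFace S.cone F) : (0 : A) ∈ F := by
  obtain ⟨x, hx⟩ := hF.nonempty
  refine hF.isExtreme.left_mem_of_mem_openSegment S.zero_mem_cone
    (smul_mem_cone zero_le_two (face_subset hF hx)) hx
    ⟨1 / 2, 1 / 2, by norm_num, by norm_num, by norm_num, by module⟩

theorem face_smul_mem (hF : IsFace S.cone F) {r : ℝ} (hr : 0 ≤ r) {x : A} (hx : x ∈ F) :
    r • x ∈ F := by
  rcases le_or_gt r 1 with h | h
  · have := hF.convex hx (face_zero_mem hF) hr (sub_nonneg.2 h) (by ring)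
    simpa using this
  · refine hF.isExtreme.right_mem_of_mem_openSegment S.zero_mem_cone
      (smul_mem_cone hr (face_subset hF hx)) hx
      ⟨1 - r⁻¹, r⁻¹, sub_pos.2 (inv_lt_one_of_one_lt₀ h), by positivity, by ring, ?_⟩
    rw [smul_zero, zero_add, smul_smul, inv_mul_cancel₀ (by positivity), one_smul]

theorem face_mem_of_smul_mem (hF : IsFace S.cone F) {r : ℝ} (hr : 0 < r) {x : A}
    (hx : r • x ∈ F) : x ∈ F := by
  have := face_smul_mem hF (inv_nonneg.2 hr.le) hx
  rwa [smul_smul, inv_mul_cancel₀ hr.ne', one_smul] at this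

theorem face_add_mem (hF : IsFace S.cone F) {x y : A} (hx : x ∈ F) (hy : y ∈ F) : x + y ∈ F := by
  have := face_smul_mem hF zero_le_two (hF.convex hx hy (by norm_num : (0 : ℝ) ≤ 1 / 2)
    (by norm_num : (0 : ℝ) ≤ 1 / 2) (by norm_num))
  convert this using 1
  module

theorem face_sum_mem (hF : IsFace S.cone F) {ι : Type*} {s : Finset ι} {f : ι → A}
    (h : ∀ i ∈ s, f i ∈ F) : ∑ i ∈ s, f i ∈ F :=
  Finset.sum_induction f (· ∈ F) (fun _ _ => face_add_mem hF) (face_zero_mem hF) h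

theorem face_left_mem (hF : IsFace S.cone F) {x y : A} (hx : x ∈ S.cone) (hy : y ∈ S.cone)
    (h : x + y ∈ F) : x ∈ F := by
  refine face_mem_of_smul_mem hF two_pos (hF.isExtreme.left_mem_of_mem_openSegment
    (smul_mem_cone zero_le_two hx) (smul_mem_cone zero_le_two hy) h
    ⟨1 / 2, 1 / 2, by norm_num, by norm_num, by norm_num, by module⟩)

theorem face_mem_of_sum_mem (hF : IsFace S.cone F) {ι : Type*} {s : Finset ι} {f : ι → A}
    (hf : ∀ i ∈ s, f i ∈ S.cone) (h : ∑ i ∈ s, f i ∈ F) {i : ι} (hi : i ∈ s) : f i ∈ F := by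
  classical
  rw [← Finset.add_sum_erase s f hi] at h
  exact face_left_mem hF (hf i hi) (sum_mem_cone _ fun j hj => hf j (Finset.mem_of_mem_erase hj)) h

theorem isFace_of_subcone (h0 : (0 : A) ∈ F) (hsub : F ⊆ S.cone)
    (hadd : ∀ x ∈ F, ∀ y ∈ F, x + y ∈ F) (hsmul : ∀ r : ℝ, 0 ≤ r → ∀ x ∈ F, r • x ∈ F)
    (hleft : ∀ x ∈ S.cone, ∀ y ∈ S.cone, x + y ∈ F → x ∈ F) : IsFace S.cone F := by
  refine ⟨⟨0, h0⟩, fun x hx y hy a b ha hb _ => hadd _ (hsmul a ha x hx) _ (hsmul b hb y hy),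
    hsub, ?_⟩
  rintro x hx y hy z hz ⟨a, b, ha, hb, -, rfl⟩
  have := hsmul a⁻¹ (by positivity) _
    (hleft _ (smul_mem_cone ha.le hx) _ (smul_mem_cone hb.le hy) hz)
  rwa [smul_smul, inv_mul_cancel₀ ha.ne', one_smul] at this

variable (S) in
theorem isFace_cone : IsFace S.cone S.cone :=
  isFace_of_subcone S.zero_mem_cone subset_rfl (fun _ hx _ hy => add_mem_cone hx hy)
    (fun _ hr _ hx => smul_mem_cone hr hx) fun _ hx _ _ _ => hx

theorem isFace_zeros {f : Module.Dual ℝ A} (hf : ∀ x ∈ S.cone, 0 ≤ f x) :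
    IsFace S.cone {x | x ∈ S.cone ∧ f x = 0} := by
  refine isFace_of_subcone ⟨S.zero_mem_cone, map_zero f⟩ (fun x hx => hx.1)
    (fun x hx y hy => ⟨add_mem_cone hx.1 hy.1, by rw [map_add, hx.2, hy.2, add_zero]⟩)
    (fun r hr x hx => ⟨smul_mem_cone hr hx.1, by rw [map_smul, hx.2, smul_zero]⟩)
    fun x hx y hy h => ⟨hx, ?_⟩
  have h1 := h.2
  rw [map_add] at h1
  linarith [hf x hx, hf y hy]

theorem subset_generatedFace (M : Set A) : M ⊆ generatedFace S.cone M :=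
  fun _ hx _ hH => hH.2 hx

theorem generatedFace_subset {M : Set A} (hH : IsFace S.cone H) (h : M ⊆ H) :
    generatedFace S.cone M ⊆ H := fun _ hx => hx H ⟨hH, h⟩

theorem isFace_generatedFace {M : Set A} (hM : M ⊆ S.cone) :
    IsFace S.cone (generatedFace S.cone M) :=
  isFace_of_subcone (fun _ hH => face_zero_mem hH.1) (generatedFace_subset S.isFace_cone hM)
    (fun _ hx _ hy H hH => face_add_mem hH.1 (hx H hH) (hy H hH))
    (fun _ hr _ hx H hH => face_smul_mem hH.1 hr (hx H hH))
    fun _ hx _ hy hxy H hH => face_left_mem hH.1 hx hy (hxy H hH)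

theorem generatedFace_eq_of_face (hF : IsFace S.cone F) : generatedFace S.cone F = F :=
  (generatedFace_subset hF subset_rfl).antisymm (subset_generatedFace F)

theorem generatedFace_mono {M N : Set A} (h : M ⊆ N) :
    generatedFace S.cone M ⊆ generatedFace S.cone N := fun _ hx H hH => hx H ⟨hH.1, h.trans hH.2⟩

/-- The elements of the cone dominated by a multiple of `x` already form a face containing `x`. -/
theorem exists_smul_sub_mem_cone {x z : A} (hx : x ∈ S.cone)
    (hz : z ∈ generatedFace S.cone {x}) : ∃ t : ℝ, 0 ≤ t ∧ t • x - z ∈ S.cone := by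
  have hface : IsFace S.cone {z | z ∈ S.cone ∧ ∃ t : ℝ, 0 ≤ t ∧ t • x - z ∈ S.cone} := by
    refine isFace_of_subcone ⟨S.zero_mem_cone, 0, le_rfl, by simpa using S.zero_mem_cone⟩
      (fun y hy => hy.1) ?_ ?_ ?_
    · rintro a ⟨ha, s, hs, hsa⟩ b ⟨hb, t, ht, htb⟩
      refine ⟨add_mem_cone ha hb, s + t, add_nonneg hs ht, ?_⟩
      convert add_mem_cone hsa htb using 1
      module
    · rintro r hr a ⟨ha, s, hs, hsa⟩
      refine ⟨smul_mem_cone hr ha, r * s, mul_nonneg hr hs, ?_⟩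
      convert smul_mem_cone hr hsa using 1
      module
    · rintro a ha b hb ⟨-, t, ht, h⟩
      refine ⟨ha, t, ht, ?_⟩
      convert add_mem_cone h hb using 1
      module
  exact (generatedFace_subset hface
    (Set.singleton_subset_iff.2 ⟨hx, 1, zero_le_one, by simpa using S.zero_mem_cone⟩) hz).2

theorem generatedFace_range_eq_singleton {ι : Type*} [Fintype ι] {w : ι → A}
    (hw : ∀ i, w i ∈ S.cone) {c : ι → ℝ} (hc : ∀ i, 0 < c i) :
    generatedFace S.cone (Set.range w) = generatedFace S.cone {∑ i, c i • w i} := by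
  have hcw : ∀ i, c i • w i ∈ S.cone := fun i => smul_mem_cone (hc i).le (hw i)
  have hface := isFace_generatedFace (S := S) (Set.range_subset_iff.2 hw)
  have hface' := isFace_generatedFace (S := S)
    (Set.singleton_subset_iff.2 (sum_mem_cone Finset.univ fun i _ => hcw i))
  apply Set.Subset.antisymm
  · refine generatedFace_subset hface' (Set.range_subset_iff.2 fun i => ?_)
    exact face_mem_of_smul_mem hface' (hc i) (face_mem_of_sum_mem hface' (fun i _ => hcw i)
      (subset_generatedFace _ rfl) (Finset.mem_univ i))
  · refine generatedFace_subset hface (Set.singleton_subset_iff.2 (face_sum_mem hface fun i _ => ?_))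
    exact face_smul_mem hface (hc i).le (subset_generatedFace _ ⟨i, rfl⟩)

theorem generatedFace_range_eq_sum {ι : Type*} [Fintype ι] {w : ι → A}
    (hw : ∀ i, w i ∈ S.cone) :
    generatedFace S.cone (Set.range w) = generatedFace S.cone {∑ i, w i} := by
  simpa using generatedFace_range_eq_singleton hw (c := fun _ => 1) fun _ => one_pos

theorem exists_sub_of_mem_span (hF : IsFace S.cone F) {x : A} (hx : x ∈ Submodule.span ℝ F) :
    ∃ a ∈ F, ∃ b ∈ F, x = a - b := by
  induction hx using Submodule.span_induction with
  | mem x hx => exact ⟨x, hx, 0, face_zero_mem hF, by simp⟩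
  | zero => exact ⟨0, face_zero_mem hF, 0, face_zero_mem hF, by simp⟩
  | add x y _ _ hx hy =>
    obtain ⟨a, ha, b, hb, rfl⟩ := hx
    obtain ⟨c, hc, d, hd, rfl⟩ := hy
    exact ⟨a + c, face_add_mem hF ha hc, b + d, face_add_mem hF hb hd, by abel⟩
  | smul r x _ hx =>
    obtain ⟨a, ha, b, hb, rfl⟩ := hx
    rcases le_total 0 r with hr | hr
    · exact ⟨r • a, face_smul_mem hF hr ha, r • b, face_smul_mem hF hr hb, smul_sub _ _ _⟩
    · refine ⟨(-r) • b, face_smul_mem hF (by linarith) hb, (-r) • a,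
        face_smul_mem hF (by linarith) ha, ?_⟩
      module

/-- If `x = a - b` with `a, b ∈ F`, then `x + b ∈ F`, and the face property returns `x`. -/
theorem face_eq_of_subset_span (hF : IsFace S.cone F) (hH : IsFace S.cone H) (hFH : F ⊆ H)
    (h : H ⊆ Submodule.span ℝ F) : F = H := by
  refine hFH.antisymm fun x hx => ?_
  obtain ⟨a, ha, b, hb, rfl⟩ := exists_sub_of_mem_span hF (h hx)
  refine face_left_mem hF (face_subset hH hx) (face_subset hF hb) ?_
  rwa [sub_add_cancel]

/-- The sum of a basis of the span chosen inside `F` generates a face containing each basis vector,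
hence one with the same span. -/
theorem exists_generatedFace_singleton [FiniteDimensional ℝ A] (hF : IsFace S.cone F) :
    ∃ x ∈ F, generatedFace S.cone {x} = F := by
  obtain ⟨b, hbF, hbspan, hbli⟩ := exists_linearIndependent ℝ F
  have : Finite b := hbli.finite
  have : Fintype b := Fintype.ofFinite b
  have hb : ∀ i : b, (i : A) ∈ S.cone := fun i => face_subset hF (hbF i.2)
  have hx : ∑ i : b, (i : A) ∈ F := face_sum_mem hF fun i _ => hbF i.2
  refine ⟨_, hx, face_eq_of_subset_span
    (isFace_generatedFace (Set.singleton_subset_iff.2 (face_subset hF hx))) hF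
    (generatedFace_subset hF (Set.singleton_subset_iff.2 hx)) ?_⟩
  rw [← generatedFace_range_eq_sum hb, Subtype.range_coe]
  exact fun y hy => Submodule.span_mono (subset_generatedFace b)
    (by rw [hbspan]; exact Submodule.subset_span hy)

end Faces
end GPT

/-! ### Orthonormal frames, their sums and the rank of a face. -/

namespace GPT

variable {A : Type*} [NormedAddCommGroup A] [NormedSpace ℝ A] {S : GPT A}
  {B : A →ₗ[ℝ] A →ₗ[ℝ] ℝ} {U : A}

/-- Frames, indexed by an arbitrary finite type and described by a self-dualizing form: an
orthonormal family of pure states, the sum of which is below the order unit. -/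
structure IsOrthoFrame (S : GPT A) (B : A →ₗ[ℝ] A →ₗ[ℝ] ℝ) {ι : Type*} [Fintype ι]
    (w : ι → A) : Prop where
  pure : ∀ i, w i ∈ S.pureStates
  norm : ∀ i, B (w i) (w i) = 1
  orth : ∀ i j, i ≠ j → B (w i) (w j) = 0
  sum_le : ∀ y ∈ S.cone, ∑ i, B (w i) y ≤ S.unit y

section

variable {ι κ : Type*} [Fintype ι] [Fintype κ] {w : ι → A} {v : κ → A} {F H : Set A}

theorem IsSelfDualForm.isOrthoFrame (hB : S.IsSelfDualForm B U) {k : ℕ} {w : Fin k → A}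
    (hw : S.IsFrame w) : S.IsOrthoFrame B w :=
  ⟨hw.1, fun i => by rw [hB.frame_apply k w hw, if_pos rfl],
    fun i j h => by rw [hB.frame_apply k w hw, if_neg h], hB.frame_sum_le k w hw⟩

theorem IsSelfDualForm.apply_le_unit (hB : S.IsSelfDualForm B U) (hw : S.IsOrthoFrame B w) (i : ι)
    {y : A} (hy : y ∈ S.cone) : B (w i) y ≤ S.unit y :=
  (Finset.single_le_sum (f := fun j => B (w j) y)
    (fun j _ => hB.nonneg _ (pure_mem_cone (hw.pure j)) _ hy) (Finset.mem_univ i)).trans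
    (hw.sum_le y hy)

theorem IsSelfDualForm.isFrame (hB : S.IsSelfDualForm B U) {k : ℕ} {w : Fin k → A}
    (hw : S.IsOrthoFrame B w) : S.IsFrame w := by
  refine ⟨hw.pure, fun k => pureStates_subset_states (hw.pure k), fun j => B (w j),
    fun j x hx => ⟨hB.nonneg _ (pure_mem_cone (hw.pure j)) _ hx, hB.apply_le_unit hw j hx⟩,
    hw.sum_le, fun j k => ?_⟩
  split_ifs with h
  · rw [h, hw.norm]
  · exact hw.orth j k h

theorem IsSelfDualForm.comp (hB : S.IsSelfDualForm B U) (hw : S.IsOrthoFrame B w) {f : κ → ι}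
    (hf : Function.Injective f) : S.IsOrthoFrame B (w ∘ f) := by
  classical
  refine ⟨fun i => hw.pure _, fun i => hw.norm _, fun i j h => hw.orth _ _ (hf.ne h),
    fun y hy => ?_⟩
  refine le_trans ?_ (hw.sum_le y hy)
  simp only [Function.comp_apply]
  rw [← Finset.sum_image (g := f) (s := Finset.univ) (f := fun i => B (w i) y) hf.injOn]
  exact Finset.sum_le_sum_of_subset_of_nonneg (Finset.subset_univ _) fun i _ _ =>
    hB.nonneg _ (pure_mem_cone (hw.pure i)) _ hy

theorem IsSelfDualForm.generatedByFrame (hB : S.IsSelfDualForm B U) (hw : S.IsOrthoFrame B w)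
    (hF : generatedFace S.cone (Set.range w) = F) : S.GeneratedByFrame F (Fintype.card ι) := by
  let e := (Fintype.equivFin ι).symm
  refine ⟨w ∘ e, hB.isFrame (hB.comp hw e.injective), ?_⟩
  rw [Set.range_comp, e.range_eq_univ, Set.image_univ, hF]

theorem IsOrthoFrame.mem_cone (hw : S.IsOrthoFrame B w) (i : ι) : w i ∈ S.cone :=
  pure_mem_cone (hw.pure i)

theorem IsOrthoFrame.isFace (hw : S.IsOrthoFrame B w) :
    IsFace S.cone (generatedFace S.cone (Set.range w)) :=
  isFace_generatedFace (Set.range_subset_iff.2 hw.mem_cone)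

theorem IsOrthoFrame.unit_sum (hw : S.IsOrthoFrame B w) :
    S.unit (∑ i, w i) = Fintype.card ι := by
  simp [unit_pure (hw.pure _)]

theorem IsOrthoFrame.apply_combination (hw : S.IsOrthoFrame B w) (c : ι → ℝ) (i : ι) :
    B (w i) (∑ j, c j • w j) = c i := by
  rw [map_sum, Finset.sum_eq_single i]
  · rw [map_smul, hw.norm, smul_eq_mul, mul_one]
  · intro j _ hj
    rw [map_smul, hw.orth i j hj.symm, smul_zero]
  · simp

theorem IsOrthoFrame.apply_sum (hw : S.IsOrthoFrame B w) (i : ι) :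
    B (w i) (∑ j, w j) = 1 := by
  simpa using hw.apply_combination (fun _ => 1) i

/-- On the face generated by a frame, the sum of the frame acts as the order unit. -/
theorem IsSelfDualForm.sum_apply (hB : S.IsSelfDualForm B U) (hw : S.IsOrthoFrame B w)
    {z : A} (hz : z ∈ generatedFace S.cone (Set.range w)) :
    B (∑ i, w i) z = S.unit z := by
  have hface : IsFace S.cone {x | x ∈ S.cone ∧ (S.unit - B (∑ i, w i)) x = 0} := by
    refine isFace_zeros fun x hx => ?_
    have := hw.sum_le x hx
    simpa [LinearMap.sum_apply] using this
  have := (generatedFace_subset hface (Set.range_subset_iff.2 fun i => ⟨hw.mem_cone i, ?_⟩) hz).2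
  · rw [LinearMap.sub_apply, sub_eq_zero] at this
    exact this.symm
  · rw [LinearMap.sub_apply, hB.symm, hw.apply_sum, unit_pure (hw.pure i), sub_self]

theorem IsOrthoFrame.sum_mem (hw : S.IsOrthoFrame B w) :
    ∑ i, w i ∈ generatedFace S.cone (Set.range w) :=
  face_sum_mem hw.isFace fun i _ => subset_generatedFace _ ⟨i, rfl⟩

/-- Both sums represent the order unit on the common face and lie in it, so their difference has
norm zero. -/
theorem IsSelfDualForm.sum_eq_sum (hB : S.IsSelfDualForm B U) (hw : S.IsOrthoFrame B w)
    (hv : S.IsOrthoFrame B v)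
    (h : generatedFace S.cone (Set.range w) = generatedFace S.cone (Set.range v)) :
    ∑ i, w i = ∑ i, v i := by
  have h1 := hB.sum_apply hw hw.sum_mem
  have h2 := hB.sum_apply hv hv.sum_mem
  have h3 := hB.sum_apply hw (h ▸ hv.sum_mem)
  have h4 := hB.sum_apply hv (h ▸ hw.sum_mem)
  rw [← sub_eq_zero]
  apply hB.definite
  simp only [map_sub, LinearMap.sub_apply, h1, h2, h3, h4]
  ring

/-- The product of the two frame sums equals the size of `w`, since the sum of `v` acts as the unit
there, and is at most the unit of the sum of `v`, which is the size of `v`. -/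
theorem IsSelfDualForm.card_le_of_subset (hB : S.IsSelfDualForm B U) (hw : S.IsOrthoFrame B w)
    (hv : S.IsOrthoFrame B v) (h : ∀ i, w i ∈ generatedFace S.cone (Set.range v)) :
    Fintype.card ι ≤ Fintype.card κ := by
  have h1 := hB.sum_apply hv (face_sum_mem hv.isFace (s := Finset.univ) fun i _ => h i)
  rw [hw.unit_sum, hB.symm] at h1
  have h2 := hw.sum_le _ (sum_mem_cone Finset.univ fun i _ => hv.mem_cone i)
  rw [hv.unit_sum, ← LinearMap.sum_apply, ← map_sum, h1] at h2
  exact_mod_cast h2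

theorem IsSelfDualForm.card_eq (hB : S.IsSelfDualForm B U) (hw : S.IsOrthoFrame B w)
    (hv : S.IsOrthoFrame B v)
    (h : generatedFace S.cone (Set.range w) = generatedFace S.cone (Set.range v)) :
    Fintype.card ι = Fintype.card κ :=
  (hB.card_le_of_subset hw hv fun i => h ▸ subset_generatedFace _ ⟨i, rfl⟩).antisymm
    (hB.card_le_of_subset hv hw fun i => h ▸ subset_generatedFace _ ⟨i, rfl⟩)

theorem IsSelfDualForm.exists_decomposition (hB : S.IsSelfDualForm B U)
    (hdec : S.ClassicalDecomposability) {x : A} (hx : x ∈ S.cone) :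
    ∃ (k : ℕ) (w : Fin k → A) (c : Fin k → ℝ), S.IsOrthoFrame B w ∧ (∀ i, 0 < c i) ∧
      x = ∑ i, c i • w i ∧
      generatedFace S.cone (Set.range w) = generatedFace S.cone {x} := by
  obtain ⟨k, w, c, hw, hc, rfl⟩ := exists_frame_decomposition hdec hx
  exact ⟨k, w, c, hB.isOrthoFrame hw, hc, rfl,
    generatedFace_range_eq_singleton (fun i => pure_mem_cone (hw.1 i)) hc⟩

theorem IsSelfDualForm.exists_generating_frame [FiniteDimensional ℝ A]
    (hB : S.IsSelfDualForm B U) (hdec : S.ClassicalDecomposability) (hF : IsFace S.cone F) :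
    ∃ (k : ℕ) (w : Fin k → A), S.IsOrthoFrame B w ∧ generatedFace S.cone (Set.range w) = F := by
  obtain ⟨x, hx, hxF⟩ := exists_generatedFace_singleton hF
  obtain ⟨k, w, c, hw, -, -, hgen⟩ := hB.exists_decomposition hdec (face_subset hF hx)
  exact ⟨k, w, hw, hgen.trans hxF⟩

/-- Vectors in the span of a face have a spectral decomposition within the face. -/
theorem IsSelfDualForm.exists_span_decomposition [FiniteDimensional ℝ A]
    (hB : S.IsSelfDualForm B U) (hdec : S.ClassicalDecomposability) (hF : IsFace S.cone F)
    {x : A} (hx : x ∈ Submodule.span ℝ F) :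
    ∃ (k : ℕ) (w : Fin k → A) (c : Fin k → ℝ), S.IsOrthoFrame B w ∧
      generatedFace S.cone (Set.range w) = F ∧ x = ∑ i, c i • w i := by
  obtain ⟨a, ha, b, hb, rfl⟩ := exists_sub_of_mem_span hF hx
  obtain ⟨k, w, hw, hgen⟩ := hB.exists_generating_frame hdec hF
  have hUF : ∑ i, w i ∈ F := hgen ▸ hw.sum_mem
  have hUgen : generatedFace S.cone {∑ i, w i} = F := by
    rw [← generatedFace_range_eq_sum hw.mem_cone, hgen]
  obtain ⟨t, ht, htb⟩ := exists_smul_sub_mem_cone (face_subset hF hUF) (hUgen.symm ▸ hb)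
  have htF : t • ∑ i, w i - b ∈ F := face_left_mem hF htb (face_subset hF hb) (by
    rw [sub_add_cancel]; exact face_smul_mem hF ht hUF)
  have hrest : a + (t • ∑ i, w i - b) ∈ F := face_add_mem hF ha htF
  -- The extra frame sum makes this element generate all of `F`, so the frame decomposing it has the
  -- same sum as `w`, and undoing the shift by `t + 1` keeps it diagonal.
  have hyF : ∑ i, w i + (a + (t • ∑ i, w i - b)) ∈ F := face_add_mem hF hUF hrest
  obtain ⟨m, v, c, hv, hc, heq, hvgen⟩ := hB.exists_decomposition hdec (face_subset hF hyF)
  have hvF : generatedFace S.cone (Set.range v) = F := by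
    rw [hvgen]
    apply Set.Subset.antisymm (generatedFace_subset hF (Set.singleton_subset_iff.2 hyF))
    have hface := isFace_generatedFace (S := S) (Set.singleton_subset_iff.2 (face_subset hF hyF))
    nth_rewrite 1 [← hUgen]
    exact generatedFace_subset hface (Set.singleton_subset_iff.2 (face_left_mem hface
      (face_subset hF hUF) (face_subset hF hrest) (subset_generatedFace _ rfl)))
  refine ⟨m, v, fun i => c i - (t + 1), hv, hvF, ?_⟩
  have hsum : ∑ i, v i = ∑ i, w i := hB.sum_eq_sum hv hw (hvF.trans hgen.symm)
  simp only [sub_smul, Finset.sum_sub_distrib]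
  rw [← heq, ← Finset.smul_sum, hsum]
  module

/-- Faces are self-dual within their span. -/
theorem IsSelfDualForm.mem_face_of_nonneg [FiniteDimensional ℝ A]
    (hB : S.IsSelfDualForm B U) (hdec : S.ClassicalDecomposability) (hF : IsFace S.cone F)
    {x : A} (hx : x ∈ Submodule.span ℝ F) (h : ∀ z ∈ F, 0 ≤ B x z) : x ∈ F := by
  obtain ⟨k, w, c, hw, rfl, rfl⟩ := hB.exists_span_decomposition hdec hF hx
  refine face_sum_mem hF fun i _ => face_smul_mem hF ?_ (subset_generatedFace _ ⟨i, rfl⟩)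
  rw [← hw.apply_combination c i, hB.symm]
  exact h _ (subset_generatedFace _ ⟨i, rfl⟩)

/-- Every frame in a face extends to a frame which generates the face. -/
theorem IsSelfDualForm.exists_extension [FiniteDimensional ℝ A]
    (hB : S.IsSelfDualForm B U) (hdec : S.ClassicalDecomposability) (hF : IsFace S.cone F)
    (hw : S.IsOrthoFrame B w) (hwF : ∀ i, w i ∈ F) :
    ∃ (k : ℕ) (x : Fin k → A), S.IsOrthoFrame B (Sum.elim w x) ∧
      generatedFace S.cone (Set.range (Sum.elim w x)) = F := by
  obtain ⟨m, v, hv, rfl⟩ := hB.exists_generating_frame hdec hF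
  have hsumF := face_sum_mem hF (s := Finset.univ) fun i _ => hwF i
  -- The complement of `w` in the face. It is in the face by self-duality there; its spectral
  -- decomposition is orthogonal to `w` with all coefficients one.
  have hy : ∑ i, v i - ∑ i, w i ∈ generatedFace S.cone (Set.range v) := by
    refine hB.mem_face_of_nonneg hdec hF (Submodule.sub_mem _
      (Submodule.subset_span hv.sum_mem) (Submodule.subset_span hsumF)) fun z hz => ?_
    rw [map_sub, LinearMap.sub_apply, hB.sum_apply hv hz, sub_nonneg, map_sum,
      LinearMap.sum_apply]
    exact hw.sum_le z (face_subset hF hz)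
  obtain ⟨k, x, c, hx, hc, heq, hxgen⟩ := hB.exists_decomposition hdec (face_subset hF hy)
  have hxF : ∀ j, x j ∈ generatedFace S.cone (Set.range v) := fun j =>
    (hxgen.le.trans (generatedFace_subset hF (Set.singleton_subset_iff.2 hy)))
      (subset_generatedFace _ ⟨j, rfl⟩)
  have horth : ∀ i j, B (w i) (x j) = 0 := by
    intro i j
    have h1 : B (w i) (∑ j, c j • x j) = 0 := by
      rw [← heq, map_sub, hw.apply_sum, hB.symm, hB.sum_apply hv (hwF i), unit_pure (hw.pure i),
        sub_self]
    simp only [map_sum, map_smul, smul_eq_mul] at h1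
    rw [Finset.sum_eq_zero_iff_of_nonneg fun j _ =>
      mul_nonneg (hc j).le (hB.nonneg _ (hw.mem_cone i) _ (hx.mem_cone j))] at h1
    exact (mul_eq_zero.1 (h1 j (Finset.mem_univ j))).resolve_left (hc j).ne'
  have hc1 : ∀ j, c j = 1 := by
    intro j
    rw [← hx.apply_combination c j, ← heq, map_sub, hB.symm, hB.sum_apply hv (hxF j),
      unit_pure (hx.pure j), hB.symm, map_sum, LinearMap.sum_apply,
      Finset.sum_eq_zero fun i _ => horth i j, sub_zero]
  have htotal : ∑ i, Sum.elim w x i = ∑ i, v i := by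
    simp only [hc1, one_smul] at heq
    rw [Fintype.sum_sum_type]
    simp only [Sum.elim_inl, Sum.elim_inr]
    rw [← heq, add_sub_cancel]
  have hframe : S.IsOrthoFrame B (Sum.elim w x) := by
    refine ⟨?_, ?_, ?_, fun y hy => ?_⟩
    · rintro (i | j)
      exacts [hw.pure i, hx.pure j]
    · rintro (i | j)
      exacts [hw.norm i, hx.norm j]
    · rintro (i | i) (j | j) h
      · exact hw.orth i j fun h' => h (congrArg _ h')
      · exact horth i j
      · exact (hB.symm _ _).trans (horth j i)
      · exact hx.orth i j fun h' => h (congrArg _ h')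
    · rw [← LinearMap.sum_apply, ← map_sum, htotal, map_sum, LinearMap.sum_apply]
      exact hv.sum_le y hy
  refine ⟨k, x, hframe, ?_⟩
  rw [generatedFace_range_eq_sum hframe.mem_cone, htotal, ← generatedFace_range_eq_sum hv.mem_cone]

/-! The rank of a face. -/

theorem IsSelfDualForm.rank_eq_of_generatedByFrame (hB : S.IsSelfDualForm B U) {n : ℕ}
    (h : S.GeneratedByFrame F n) : n = S.rank F := by
  have h' : S.GeneratedByFrame F (S.rank F) := Nat.sInf_mem (s := {n | S.GeneratedByFrame F n}) ⟨n, h⟩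
  obtain ⟨w, hw, hwF⟩ := h
  obtain ⟨v, hv, hvF⟩ := h'
  simpa using hB.card_eq (hB.isOrthoFrame hw) (hB.isOrthoFrame hv) (hwF.trans hvF.symm)

theorem IsSelfDualForm.rank_eq (hB : S.IsSelfDualForm B U) (hw : S.IsOrthoFrame B w)
    (hF : generatedFace S.cone (Set.range w) = F) : S.rank F = Fintype.card ι :=
  (hB.rank_eq_of_generatedByFrame (hB.generatedByFrame hw hF)).symm

theorem IsSelfDualForm.exists_frame_of_rank [FiniteDimensional ℝ A]
    (hB : S.IsSelfDualForm B U) (hdec : S.ClassicalDecomposability) (hF : IsFace S.cone F) :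
    ∃ w : Fin (S.rank F) → A, S.IsOrthoFrame B w ∧ generatedFace S.cone (Set.range w) = F := by
  obtain ⟨k, w, hw, hgen⟩ := hB.exists_generating_frame hdec hF
  have hk : S.rank F = k := by simpa using hB.rank_eq hw hgen
  rw [hk]
  exact ⟨w, hw, hgen⟩

theorem IsSelfDualForm.card_le_rank [FiniteDimensional ℝ A]
    (hB : S.IsSelfDualForm B U) (hdec : S.ClassicalDecomposability) (hF : IsFace S.cone F)
    (hw : S.IsOrthoFrame B w) (hwF : ∀ i, w i ∈ F) : Fintype.card ι ≤ S.rank F := by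
  obtain ⟨v, hv, hvF⟩ := hB.exists_frame_of_rank hdec hF
  simpa using hB.card_le_of_subset hw hv fun i => hvF.symm ▸ hwF i

/-- Extend a frame of `F` to one of `H`; if nothing is added, the faces agree. -/
theorem IsSelfDualForm.rank_lt [FiniteDimensional ℝ A]
    (hB : S.IsSelfDualForm B U) (hdec : S.ClassicalDecomposability) (hF : IsFace S.cone F)
    (hH : IsFace S.cone H) (h : F ⊂ H) : S.rank F < S.rank H := by
  obtain ⟨w, hw, hwF⟩ := hB.exists_frame_of_rank hdec hF
  have hwH : ∀ i, w i ∈ H := fun i => h.1 (hwF.le (subset_generatedFace _ ⟨i, rfl⟩))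
  obtain ⟨k, x, hx, hxH⟩ := hB.exists_extension hdec hH hw hwH
  have hr := hB.rank_eq hx hxH
  rw [Fintype.card_sum, Fintype.card_fin, Fintype.card_fin] at hr
  rcases Nat.eq_zero_or_pos k with rfl | hk
  · refine absurd ?_ h.ne
    rw [← hwF, ← hxH, Set.Sum.elim_range]
    simp
  · omega

end
end GPT

/-! ### The covering property and the max-entropies in terms of ranks. -/

namespace GPT

variable {A : Type*} [NormedAddCommGroup A] [NormedSpace ℝ A] {S : GPT A}
  {B : A →ₗ[ℝ] A →ₗ[ℝ] ℝ} {U : A} {F H : Set A}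

theorem logb_natCast_mono {m n : ℕ} (h : m ≤ n) : Real.logb 2 (m : ℝ) ≤ Real.logb 2 n := by
  rcases Nat.eq_zero_or_pos m with rfl | hm
  · rw [Nat.cast_zero, Real.logb_zero]
    rcases Nat.eq_zero_or_pos n with rfl | hn
    · simp
    · exact Real.logb_nonneg one_lt_two (by exact_mod_cast hn)
  · exact Real.logb_le_logb_of_le one_lt_two (by exact_mod_cast hm) (by exact_mod_cast h)

/-- Positivity of `n` is essential: with the convention `Real.logb 2 0 = 0`, the pair `m = 1`, `n =
0` would be a counterexample. -/
theorem le_of_logb_natCast_le {m n : ℕ} (hn : 0 < n)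
    (h : Real.logb 2 (m : ℝ) ≤ Real.logb 2 n) : m ≤ n := by
  rcases Nat.eq_zero_or_pos m with rfl | hm
  · exact Nat.zero_le _
  · exact_mod_cast (Real.logb_le_logb one_lt_two (by exact_mod_cast hm) (by exact_mod_cast hn)).1 h

theorem classicalMaxEntropy_nonneg {n : ℕ} (p : Fin n → ℝ) : 0 ≤ classicalMaxEntropy p := by
  have := logb_natCast_mono (Nat.zero_le (Set.ncard {i : Fin n | 0 < p i}))
  simpa [classicalMaxEntropy] using this

/-! Adjoining pure states to a face. -/

theorem join_subset_cone (hF : IsFace S.cone F) {w : A} (hw : w ∈ S.pureStates) :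
    F ∪ {w} ⊆ S.cone :=
  Set.union_subset (face_subset hF) (Set.singleton_subset_iff.2 (pure_mem_cone hw))

theorem isFace_faceJoin (hF : IsFace S.cone F) {w : A} (hw : w ∈ S.pureStates) :
    IsFace S.cone (S.faceJoin F w) := isFace_generatedFace (join_subset_cone hF hw)

theorem subset_faceJoin (F : Set A) (w : A) : F ⊆ S.faceJoin F w :=
  Set.subset_union_left.trans (subset_generatedFace _)

theorem coveringProperty_iff_rank [FiniteDimensional ℝ A] (hB : S.IsSelfDualForm B U)
    (hdec : S.ClassicalDecomposability) :
    S.CoveringProperty ↔ ∀ F : Set A, IsFace S.cone F → ∀ w ∈ S.pureStates,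
      S.rank (S.faceJoin F w) ≤ S.rank F + 1 := by
  refine ⟨fun hcov F hF w hw => ?_, fun h F hF w hw => ?_⟩
  · rcases hcov F hF w hw with heq | ⟨hss, hno⟩
    · rw [heq]; exact Nat.le_succ _
    by_contra! hlt
    have hG := isFace_faceJoin hF hw
    obtain ⟨v, hv, hvF⟩ := hB.exists_frame_of_rank hdec hF
    have hvG : ∀ i, v i ∈ S.faceJoin F w := fun i =>
      hss.1 (hvF.le (subset_generatedFace _ ⟨i, rfl⟩))
    obtain ⟨k, x, hx, hxG⟩ := hB.exists_extension hdec hG hv hvG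
    have hr := hB.rank_eq hx hxG
    rw [Fintype.card_sum, Fintype.card_fin, Fintype.card_fin] at hr
    have hk : 0 < k := by omega
    -- Adding just one vector of the extension to the frame of `F` gives a face of rank `S.rank F +
    -- 1`, strictly between `F` and the join.
    let f : Option (Fin (S.rank F)) → Fin (S.rank F) ⊕ Fin k :=
      fun o => o.elim (Sum.inr ⟨0, hk⟩) Sum.inl
    have hf : Function.Injective f := by
      rintro (_ | i) (_ | j) h <;> simp_all [f]
    have hframe := hB.comp hx hf
    have hHF : F ⊆ generatedFace S.cone (Set.range (Sum.elim v x ∘ f)) :=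
      hvF.ge.trans (generatedFace_mono (by rintro _ ⟨i, rfl⟩; exact ⟨some i, rfl⟩))
    have hHG : generatedFace S.cone (Set.range (Sum.elim v x ∘ f)) ⊆ S.faceJoin F w :=
      (generatedFace_mono (Set.range_comp_subset_range _ _)).trans hxG.le
    have hrH := hB.rank_eq hframe rfl
    rw [Fintype.card_option, Fintype.card_fin] at hrH
    refine hno ⟨_, hframe.isFace, hHF.ssubset_of_ne ?_, hHG.ssubset_of_ne ?_⟩
    · intro h
      rw [← h] at hrH
      omega
    · intro h
      rw [h] at hrH
      omega
  · rcases eq_or_ne (S.faceJoin F w) F with heq | hne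
    · exact Or.inl heq
    · refine Or.inr ⟨(subset_faceJoin F w).ssubset_of_ne hne.symm, ?_⟩
      rintro ⟨H, hH, h1, h2⟩
      have h3 := hB.rank_lt hdec hF hH h1
      have h4 := hB.rank_lt hdec hH (isFace_faceJoin hF hw) h2
      have h5 := h F hF w hw
      omega

theorem rank_generatedFace_union_le
    (hrank : ∀ F : Set A, IsFace S.cone F → ∀ w ∈ S.pureStates,
      S.rank (S.faceJoin F w) ≤ S.rank F + 1) (hF : IsFace S.cone F)
    {ι : Type*} (s : Finset ι) {v : ι → A} (hv : ∀ i ∈ s, v i ∈ S.pureStates) :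
    S.rank (generatedFace S.cone (F ∪ v '' s)) ≤ S.rank F + s.card := by
  classical
  induction s using Finset.induction_on with
  | empty => simp [generatedFace_eq_of_face hF]
  | insert a s ha ih =>
    have hsub : F ∪ v '' s ⊆ S.cone := by
      refine Set.union_subset (face_subset hF) ?_
      rintro _ ⟨i, hi, rfl⟩
      exact pure_mem_cone (hv i (Finset.mem_insert_of_mem hi))
    have hva := hv a (Finset.mem_insert_self a s)
    have hface := isFace_generatedFace hsub
    have heq : generatedFace S.cone (F ∪ v '' (insert a s : Finset ι)) =
        S.faceJoin (generatedFace S.cone (F ∪ v '' s)) (v a) := by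
      rw [Finset.coe_insert, Set.image_insert_eq]
      have hbig : F ∪ insert (v a) (v '' s) ⊆ S.cone := by
        intro x hx
        rcases hx with hx | rfl | hx
        exacts [hsub (Or.inl hx), pure_mem_cone hva, hsub (Or.inr hx)]
      apply Set.Subset.antisymm
      · refine generatedFace_subset (isFace_faceJoin hface hva) ?_
        rintro x (hx | rfl | hx)
        · exact subset_faceJoin _ _ (subset_generatedFace _ (Or.inl hx))
        · exact subset_generatedFace _ (Or.inr rfl)
        · exact subset_faceJoin _ _ (subset_generatedFace _ (Or.inr hx))
      · refine generatedFace_subset (isFace_generatedFace hbig) (Set.union_subset ?_ ?_)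
        · exact generatedFace_mono (Set.union_subset_union_right _ (Set.subset_insert _ _))
        · exact Set.singleton_subset_iff.2 (subset_generatedFace _ (Or.inr (Or.inl rfl)))
    rw [heq, Finset.card_insert_of_notMem ha, ← add_assoc]
    exact (hrank _ hface _ hva).trans
      (Nat.succ_le_succ (ih fun i hi => hv i (Finset.mem_insert_of_mem hi)))

theorem rank_generatedFace_image_le (hB : S.IsSelfDualForm B U)
    (hrank : ∀ F : Set A, IsFace S.cone F → ∀ w ∈ S.pureStates,
      S.rank (S.faceJoin F w) ≤ S.rank F + 1)
    {ι : Type*} (s : Finset ι) {v : ι → A} (hv : ∀ i ∈ s, v i ∈ S.pureStates) :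
    S.rank (generatedFace S.cone (v '' s)) ≤ s.card := by
  -- The empty frame generates the least face, of rank zero, from which pure states are adjoined.
  have hframe : S.IsOrthoFrame B (fun i : Empty => (i.elim : A)) :=
    ⟨fun i => i.elim, fun i => i.elim, fun i => i.elim, fun y hy => by simpa using unit_nonneg hy⟩
  have h := rank_generatedFace_union_le hrank hframe.isFace s hv
  rw [hB.rank_eq hframe rfl] at h
  simp only [Fintype.card_empty, zero_add] at h
  have heq : generatedFace S.cone (v '' s) = generatedFace S.cone
      (generatedFace S.cone (Set.range (fun i : Empty => (i.elim : A))) ∪ v '' s) := by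
    have hsub : v '' s ⊆ S.cone := by
      rintro _ ⟨i, hi, rfl⟩
      exact pure_mem_cone (hv i hi)
    apply Set.Subset.antisymm (generatedFace_mono Set.subset_union_right)
    exact generatedFace_subset (isFace_generatedFace hsub)
      (Set.union_subset (generatedFace_mono (by rintro _ ⟨i, -⟩; exact i.elim))
        (subset_generatedFace _))
  rwa [heq]

/-! The spectral and the decomposition max-entropy. -/

/-- The link between entropy and rank: the states with positive weight, whose number `H_0` counts,
generate the face of the mixture. -/
theorem generatedFace_of_decomposition {n : ℕ} {x : A} {p : Fin n → ℝ} {v : Fin n → A}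
    (hp : ∀ i, 0 ≤ p i) (hv : ∀ i, v i ∈ S.pureStates) (hx : x = ∑ i, p i • v i) :
    generatedFace S.cone (Set.range fun i : {i // 0 < p i} => v i) =
      generatedFace S.cone {x} := by
  classical
  rw [generatedFace_range_eq_singleton (w := fun i : {i // 0 < p i} => v i)
    (c := fun i : {i // 0 < p i} => p i)
    (fun i => pure_mem_cone (hv i)) fun i => i.2, hx]
  congr 2
  rw [← Finset.sum_filter_of_ne (p := fun i => 0 < p i)]
  · exact (Finset.sum_subtype _ (by simp) (fun i => p i • v i)).symm
  · intro i _ hi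
    exact (hp i).lt_of_ne fun h => hi (by rw [← h, zero_smul])

theorem IsSelfDualForm.classicalMaxEntropy_eq (hB : S.IsSelfDualForm B U) {n : ℕ} {x : A}
    {p : Fin n → ℝ} {v : Fin n → A} (h : S.IsClassicalDecomposition x p v) :
    classicalMaxEntropy p = Real.logb 2 (S.rank (generatedFace S.cone {x}) : ℝ) := by
  obtain ⟨hp, hv, hx⟩ := h
  have hframe := hB.comp (hB.isOrthoFrame hv) (f := fun i : {i // 0 < p i} => (i : Fin n))
    Subtype.val_injective
  rw [hB.rank_eq hframe (generatedFace_of_decomposition hp.1 hv.1 hx), classicalMaxEntropy,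
    ← Nat.card_eq_fintype_card]
  rfl

theorem IsSelfDualForm.spectralMaxEntropy_eq (hB : S.IsSelfDualForm B U)
    (hdec : S.ClassicalDecomposability) {x : A} (hx : x ∈ S.states) :
    S.spectralMaxEntropy x = Real.logb 2 (S.rank (generatedFace S.cone {x}) : ℝ) := by
  have : {h | ∃ (n : ℕ) (p : Fin n → ℝ) (v : Fin n → A),
      S.IsClassicalDecomposition x p v ∧ h = classicalMaxEntropy p} =
      {Real.logb 2 (S.rank (generatedFace S.cone {x}) : ℝ)} := by
    ext h
    constructor
    · rintro ⟨n, p, v, hd, rfl⟩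
      exact hB.classicalMaxEntropy_eq hd
    · rintro rfl
      obtain ⟨n, p, v, hd⟩ := hdec x hx
      exact ⟨n, p, v, hd, (hB.classicalMaxEntropy_eq hd).symm⟩
  rw [spectralMaxEntropy, this, csInf_singleton]

theorem decompositionMaxEntropy_le {n : ℕ} {x : A} {q : Fin n → ℝ} {v : Fin n → A}
    (h : S.IsPureDecomposition x q v) : S.decompositionMaxEntropy x ≤ classicalMaxEntropy q :=
  csInf_le ⟨0, by rintro _ ⟨_, q, _, _, rfl⟩; exact classicalMaxEntropy_nonneg q⟩
    ⟨n, q, v, h, rfl⟩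

theorem measurementMaxEntropy_le {n : ℕ} (x : A) {e : Fin n → Module.Dual ℝ A}
    (h : S.IsFineGrained e) :
    S.measurementMaxEntropy x ≤ classicalMaxEntropy (fun j => e j x) :=
  csInf_le ⟨0, by rintro _ ⟨_, e, _, rfl⟩; exact classicalMaxEntropy_nonneg _⟩ ⟨n, e, h, rfl⟩

theorem IsSelfDualForm.decompositionMaxEntropy_eq (hB : S.IsSelfDualForm B U)
    (hdec : S.ClassicalDecomposability)
    (hrank : ∀ F : Set A, IsFace S.cone F → ∀ w ∈ S.pureStates,
      S.rank (S.faceJoin F w) ≤ S.rank F + 1) {x : A} (hx : x ∈ S.states) :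
    S.decompositionMaxEntropy x = S.spectralMaxEntropy x := by
  classical
  obtain ⟨n, p, v, hd⟩ := hdec x hx
  have hpd : S.IsPureDecomposition x p v := ⟨hd.1, hd.2.1.1, hd.2.2⟩
  rw [hB.spectralMaxEntropy_eq hdec hx]
  apply le_antisymm
  · exact (decompositionMaxEntropy_le hpd).trans_eq (hB.classicalMaxEntropy_eq hd)
  · refine le_csInf ⟨_, n, p, v, hpd, rfl⟩ ?_
    rintro _ ⟨m, q, y, ⟨hq, hy, hsum⟩, rfl⟩
    refine logb_natCast_mono ?_
    rw [← generatedFace_of_decomposition hq.1 hy hsum]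
    have := rank_generatedFace_image_le hB hrank (Finset.univ.filter fun i => 0 < q i)
      (v := y) fun i _ => hy i
    rw [← Set.ncard_coe_finset] at this
    have h1 : ((Finset.univ.filter fun i => 0 < q i : Finset (Fin m)) : Set (Fin m)) =
        {i | 0 < q i} := by simp
    rw [h1] at this
    rwa [Set.image_eq_range] at this

theorem IsSelfDualForm.rank_le_of_maxEntropy [FiniteDimensional ℝ A] (hB : S.IsSelfDualForm B U)
    (hdec : S.ClassicalDecomposability)
    (h : ∀ w ∈ S.states, S.decompositionMaxEntropy w = S.spectralMaxEntropy w)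
    (hF : IsFace S.cone F) {w : A} (hw : w ∈ S.pureStates) :
    S.rank (S.faceJoin F w) ≤ S.rank F + 1 := by
  obtain ⟨v, hv, hvF⟩ := hB.exists_frame_of_rank hdec hF
  -- The uniform mixture of `w` and a frame of `F` generates the join and uses `S.rank F + 1` pure
  -- states, so its decomposition entropy bounds the rank of the join.
  let y : Fin (S.rank F + 1) → A := Fin.cons w v
  let c : ℝ := ((S.rank F + 1 : ℕ) : ℝ)⁻¹
  have hc : 0 < c := by positivity
  have hy : ∀ i, y i ∈ S.pureStates := by
    intro i
    cases i using Fin.cases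
    exacts [hw, hv.pure _]
  have hq : IsProbDist (fun _ : Fin (S.rank F + 1) => c) := by
    refine ⟨fun _ => hc.le, ?_⟩
    rw [Finset.sum_const, Finset.card_univ, Fintype.card_fin, nsmul_eq_mul]
    exact mul_inv_cancel₀ (by positivity)
  set x := ∑ i, c • y i with hx
  have hxs : x ∈ S.states := S.convex_states.sum_mem (fun i _ => hq.1 i) hq.2
    fun i _ => pureStates_subset_states (hy i)
  have hle := decompositionMaxEntropy_le (S := S) ⟨hq, hy, hx⟩
  have hgen : generatedFace S.cone {x} = S.faceJoin F w := by
    rw [hx, ← generatedFace_range_eq_singleton (fun i => pure_mem_cone (hy i)) fun _ => hc]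
    have hface := isFace_generatedFace (S := S)
      (Set.range_subset_iff.2 fun i => pure_mem_cone (hy i))
    apply Set.Subset.antisymm
    · refine generatedFace_mono (Set.range_subset_iff.2 fun i => ?_)
      cases i using Fin.cases with
      | zero => exact Or.inr rfl
      | succ i => exact Or.inl (hvF.le (subset_generatedFace _ ⟨i, rfl⟩))
    · refine generatedFace_subset hface (Set.union_subset ?_ ?_)
      · nth_rewrite 1 [← hvF]
        exact generatedFace_mono (Set.range_subset_iff.2 fun i => ⟨i.succ, rfl⟩)
      · exact Set.singleton_subset_iff.2 (subset_generatedFace _ ⟨0, rfl⟩)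
  rw [h x hxs, hB.spectralMaxEntropy_eq hdec hxs, hgen, classicalMaxEntropy] at hle
  have hset : {i : Fin (S.rank F + 1) | 0 < c} = Set.univ := by
    ext; simp [hc]
  rw [hset, Set.ncard_univ, Nat.card_eq_fintype_card, Fintype.card_fin] at hle
  exact le_of_logb_natCast_le (Nat.succ_pos _) hle

/-! Fine-grained measurements. -/

theorem IsSelfDualForm.apply_injective (hB : S.IsSelfDualForm B U) :
    Function.Injective B := by
  intro x y h
  rw [← sub_eq_zero]
  apply hB.definite
  rw [map_sub B, h, sub_self, LinearMap.zero_apply]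

theorem IsSelfDualForm.exists_representation [FiniteDimensional ℝ A] (hB : S.IsSelfDualForm B U)
    {e : Module.Dual ℝ A} (he : ∀ x ∈ S.cone, 0 ≤ e x) : ∃ y ∈ S.cone, B y = e := by
  obtain ⟨y, rfl⟩ := (LinearMap.injective_iff_surjective_of_finrank_eq_finrank
    (Subspace.dual_finrank_eq (K := ℝ) (V := A)).symm).1 hB.apply_injective e
  exact ⟨y, hB.mem_cone y he, rfl⟩

theorem exists_smul_of_add_eq_pure {v y z : A} (hv : v ∈ S.pureStates) (hy : y ∈ S.cone)
    (hz : z ∈ S.cone) (h : y + z = v) : ∃ c : ℝ, y = c • v := by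
  have hu := unit_pure hv
  obtain ⟨a, ha, p, hp, rfl⟩ := hy
  obtain ⟨b, hb, q, hq, rfl⟩ := hz
  rw [← h, map_add, map_smul, map_smul, unit_state hp, unit_state hq, smul_eq_mul, smul_eq_mul,
    mul_one, mul_one] at hu
  rcases ha.eq_or_lt with rfl | ha
  · exact ⟨0, by simp⟩
  rcases hb.eq_or_lt with rfl | hb
  · exact ⟨1, by rw [← h]; simp⟩
  refine ⟨a, ?_⟩
  rw [hv.2 hp hq ⟨a, b, ha, hb, hu, h⟩]

/-- By self-duality effects are represented by cone vectors, so refining an outcome splits a pure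
state inside the cone, which can only give multiples of it. -/
theorem IsSelfDualForm.isFineGrained [FiniteDimensional ℝ A] (hB : S.IsSelfDualForm B U) {n : ℕ}
    {v : Fin n → A} (hv : S.IsOrthoFrame B v) (hsum : ∑ i, v i = U) :
    S.IsFineGrained fun i => B (v i) := by
  refine ⟨⟨fun j x hx => ⟨hB.nonneg _ (hv.mem_cone j) _ hx, hB.apply_le_unit hv j hx⟩, ?_⟩,
    fun m e' M ⟨he', hM⟩ j => ?_⟩
  · rw [← map_sum, hsum, hB.unit_eq]
  · obtain ⟨y, hy, hye⟩ := hB.exists_representation fun x hx => (he'.1 j x hx).1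
    obtain ⟨z, hz, hze⟩ := hB.exists_representation
      (e := ∑ i ∈ (Finset.univ.filter fun i => M i = M j).erase j, e' i) fun x hx => by
        rw [LinearMap.sum_apply]
        exact Finset.sum_nonneg fun i _ => (he'.1 i x hx).1
    obtain ⟨c, hc⟩ := exists_smul_of_add_eq_pure (hv.pure (M j)) hy hz (hB.apply_injective (by
      rw [map_add, hye, hze, Finset.add_sum_erase _ _ (by simp)]
      exact hM (M j)))
    exact ⟨c, by rw [← hye, hc, map_smul]⟩

/-- The outcomes of a fine-grained measurement are multiples of pure states. -/
theorem IsSelfDualForm.exists_pure_of_isFineGrained (hB : S.IsSelfDualForm B U)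
    (hdec : S.ClassicalDecomposability) {n : ℕ} {e : Fin n → Module.Dual ℝ A}
    (he : S.IsFineGrained e) {k : Fin n} {y : A} (hy : y ∈ S.cone) (hye : B y = e k)
    (hy0 : y ≠ 0) : ∃ x ∈ S.pureStates, ∃ c : ℝ, 0 ≤ c ∧ y = c • x := by
  obtain ⟨m, w, c, hw, hc, rfl⟩ := exists_frame_decomposition hdec hy
  have hm : 0 < m := by
    rcases Nat.eq_zero_or_pos m with rfl | h
    · simp at hy0
    · exact h
  let i₀ : Fin m := ⟨0, hm⟩
  set a : Module.Dual ℝ A := B (c i₀ • w i₀) with ha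
  have hac : c i₀ • w i₀ ∈ S.cone := smul_mem_cone (hc i₀).le (pure_mem_cone (hw.1 i₀))
  have hrest : ∑ i ∈ Finset.univ.erase i₀, c i • w i ∈ S.cone :=
    sum_mem_cone _ fun i _ => smul_mem_cone (hc i).le (pure_mem_cone (hw.1 i))
  have hsplit : e k - a = B (∑ i ∈ Finset.univ.erase i₀, c i • w i) := by
    rw [← hye, ha, ← map_sub, ← Finset.add_sum_erase _ _ (Finset.mem_univ i₀),
      add_sub_cancel_left]
  have ha0 : ∀ x ∈ S.cone, 0 ≤ a x := fun x hx => hB.nonneg _ hac x hx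
  have hak : ∀ x ∈ S.cone, 0 ≤ e k x - a x := fun x hx => by
    rw [← LinearMap.sub_apply, hsplit]; exact hB.nonneg _ hrest x hx
  -- Split one spectral term `a` off the outcome `k` as a new outcome `0`, which is merged back into
  -- `k`. Fine-grainedness makes `a` proportional to `e k`, so `y` is a multiple of one pure state.
  let e' : Fin (n + 1) → Module.Dual ℝ A := Fin.cons a fun j => e j - if j = k then a else 0
  have hsum : ∀ s : Finset (Fin n), ∑ j ∈ s, (e j - if j = k then a else 0) =
      ∑ j ∈ s, e j - if k ∈ s then a else 0 := fun s => by
    rw [Finset.sum_sub_distrib, Finset.sum_ite_eq']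
  have hmeas : S.IsMeasurement e' := by
    refine ⟨fun j => ?_, ?_⟩
    · cases j using Fin.cases with
      | zero =>
        intro x hx
        have h1 := hak x hx
        exact ⟨ha0 x hx, by have := (he.1.1 k x hx).2; change a x ≤ _; linarith⟩
      | succ j =>
        intro x hx
        change 0 ≤ (e j - if j = k then a else 0) x ∧ (e j - if j = k then a else 0) x ≤ _
        have h1 := he.1.1 j x hx
        split_ifs with h
        · subst h
          have := hak x hx
          have := ha0 x hx
          rw [LinearMap.sub_apply]
          exact ⟨by linarith, by linarith⟩
        · simpa using h1
    · rw [Fin.sum_univ_succ]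
      simp only [e', Fin.cons_zero, Fin.cons_succ]
      rw [hsum, if_pos (Finset.mem_univ k), he.1.2]
      abel
  obtain ⟨c', hc'⟩ := he.2 (n + 1) e' (Fin.cons k id) ⟨hmeas, fun l => by
    rw [Finset.sum_filter, Fin.sum_univ_succ]
    simp only [e', Fin.cons_zero, Fin.cons_succ, id]
    rw [Finset.sum_ite_eq' Finset.univ l, if_pos (Finset.mem_univ l)]
    by_cases h : l = k
    · simp [h]
    · simp [h, Ne.symm h]⟩ 0
  simp only [e', Fin.cons_zero] at hc'
  rw [ha, ← hye, ← map_smul] at hc'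
  have heq := hB.apply_injective hc'
  have hw1 := unit_pure (hw.1 i₀)
  have hc'0 : c' ≠ 0 := by
    rintro rfl
    have := congrArg S.unit heq
    simp [hw1] at this
    exact (hc i₀).ne' this
  have hform : ∑ i, c i • w i = (c'⁻¹ * c i₀) • w i₀ := by
    rw [mul_smul, heq, smul_smul, inv_mul_cancel₀ hc'0, one_smul]
  refine ⟨w i₀, hw.1 i₀, _, ?_, hform⟩
  have := unit_nonneg hy
  rwa [hform, map_smul, hw1, smul_eq_mul, mul_one] at this

theorem IsSelfDualForm.sum_eq_of_generates_cone (hB : S.IsSelfDualForm B U)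
    {ι : Type*} [Fintype ι] {w : ι → A} (hw : S.IsOrthoFrame B w)
    (h : generatedFace S.cone (Set.range w) = S.cone) : ∑ i, w i = U := by
  apply hB.apply_injective
  rw [hB.unit_eq]
  exact functional_ext_cone (S := S) fun x hx => hB.sum_apply hw (h.symm ▸ hx)

theorem IsSelfDualForm.generatedFace_U [FiniteDimensional ℝ A] (hB : S.IsSelfDualForm B U)
    (hdec : S.ClassicalDecomposability) : generatedFace S.cone {U} = S.cone := by
  obtain ⟨k, w, hw, hgen⟩ := hB.exists_generating_frame hdec S.isFace_cone
  rw [← hB.sum_eq_of_generates_cone hw hgen, ← generatedFace_range_eq_sum hw.mem_cone, hgen]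

/-- The rank of a face generated by an element and the rank of its orthogonal face add up to at most
the rank of the cone. -/
theorem IsSelfDualForm.rank_add_rank_orthogonal_le [FiniteDimensional ℝ A]
    (hB : S.IsSelfDualForm B U) (hdec : S.ClassicalDecomposability) {w : A} (hw : w ∈ S.cone) :
    S.rank (generatedFace S.cone {w}) + S.rank {z | z ∈ S.cone ∧ B w z = 0} ≤ S.rank S.cone := by
  have hperp := isFace_zeros (S := S) (f := B w) fun x hx => hB.nonneg w hw x hx
  obtain ⟨r, v, c, hv, hc, hwv, hvgen⟩ := hB.exists_decomposition hdec hw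
  obtain ⟨x, hx, hxgen⟩ := hB.exists_frame_of_rank hdec hperp
  obtain ⟨k, v', hv', hv'gen⟩ := hB.exists_extension hdec S.isFace_cone hv hv.mem_cone
  rw [hB.rank_eq hv hvgen, hB.rank_eq hv' hv'gen, Fintype.card_sum, Fintype.card_fin,
    Fintype.card_fin]
  refine Nat.add_le_add_left ?_ r
  have horth : ∀ i j, B (v i) (x j) = 0 := by
    intro i j
    have h1 : B w (x j) = 0 := (hxgen.le (subset_generatedFace _ ⟨j, rfl⟩)).2
    rw [hwv] at h1
    simp only [map_sum, map_smul, LinearMap.sum_apply, LinearMap.smul_apply, smul_eq_mul] at h1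
    rw [Finset.sum_eq_zero_iff_of_nonneg fun i _ =>
      mul_nonneg (hc i).le (hB.nonneg _ (hv.mem_cone i) _ (hx.mem_cone j))] at h1
    exact (mul_eq_zero.1 (h1 i (Finset.mem_univ i))).resolve_left (hc i).ne'
  -- The left side counts the frame of the orthogonal face. As `v` contributes nothing, only the `k`
  -- complementary vectors remain, and each contributes at most one.
  have hU : S.unit (∑ j, x j) = ∑ j, B (v' j) (∑ i, x i) := by
    rw [← hB.unit_eq, ← hB.sum_eq_of_generates_cone hv' hv'gen, Fintype.sum_sum_type]
    simp only [Sum.elim_inl, Sum.elim_inr, map_add, LinearMap.add_apply]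
    have h0 : B (∑ i, v i) (∑ i, x i) = 0 := by
      rw [map_sum]
      refine Finset.sum_eq_zero fun j _ => ?_
      rw [map_sum, LinearMap.sum_apply]
      exact Finset.sum_eq_zero fun i _ => horth i _
    rw [h0, zero_add, map_sum B, LinearMap.sum_apply]
  have hle : ∑ j, B (v' j) (∑ i, x i) ≤ ∑ _j : Fin k, (1 : ℝ) := by
    refine Finset.sum_le_sum fun j _ => ?_
    have h1 := hx.sum_le _ (hv'.mem_cone (Sum.inr j))
    rw [unit_pure (hv'.pure _), ← LinearMap.sum_apply, ← map_sum, hB.symm] at h1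
    exact h1
  rw [← hU, hx.unit_sum] at hle
  simpa using hle

theorem IsSelfDualForm.rank_le_of_isFineGrained [FiniteDimensional ℝ A]
    (hB : S.IsSelfDualForm B U) (hdec : S.ClassicalDecomposability)
    (hrank : ∀ F : Set A, IsFace S.cone F → ∀ w ∈ S.pureStates,
      S.rank (S.faceJoin F w) ≤ S.rank F + 1) {w : A} (hw : w ∈ S.cone)
    {n : ℕ} {e : Fin n → Module.Dual ℝ A} (he : S.IsFineGrained e) :
    S.rank (generatedFace S.cone {w}) ≤ Set.ncard {j | 0 < e j w} := by
  classical
  have hrep : ∀ k, ∃ y ∈ S.cone, B y = e k := fun k =>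
    hB.exists_representation fun x hx => (he.1.1 k x hx).1
  choose y hy hye using hrep
  have hpure : ∀ k, ∃ x, 0 < e k w → x ∈ S.pureStates ∧ ∃ c : ℝ, 0 ≤ c ∧ y k = c • x := by
    intro k
    by_cases hk : 0 < e k w
    · obtain ⟨x, hx, hc⟩ := hB.exists_pure_of_isFineGrained hdec he (hy k) (hye k) (by
        intro h0
        rw [← hye k, h0, map_zero, LinearMap.zero_apply] at hk
        exact hk.false)
      exact ⟨x, fun _ => ⟨hx, hc⟩⟩
    · exact ⟨0, fun h => absurd h hk⟩
  choose x hx using hpure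
  let s : Finset (Fin n) := Finset.univ.filter fun j => 0 < e j w
  have hs : ∀ j ∈ s, 0 < e j w := fun j hj => (Finset.mem_filter.1 hj).2
  have hperp := isFace_zeros (S := S) (f := B w) fun x hx => hB.nonneg w hw x hx
  have hle := rank_generatedFace_union_le hrank hperp s (v := x) fun i hi => (hx i (hs i hi)).1
  have hsub : {z | z ∈ S.cone ∧ B w z = 0} ∪ x '' s ⊆ S.cone := by
    refine Set.union_subset (face_subset hperp) ?_
    rintro _ ⟨i, hi, rfl⟩
    exact pure_mem_cone (hx i (hs i hi)).1
  have hface := isFace_generatedFace hsub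
  have hyU : ∑ k, y k = U := by
    apply hB.apply_injective
    rw [map_sum, hB.unit_eq, ← he.1.2]
    exact Finset.sum_congr rfl fun k _ => hye k
  -- The representatives `y k` sum to `U`, which generates the cone. Each is orthogonal to `w` when
  -- its outcome has probability zero, and otherwise a multiple of the pure state `x k`.
  have hfull : generatedFace S.cone ({z | z ∈ S.cone ∧ B w z = 0} ∪ x '' s) = S.cone := by
    apply (face_subset hface).antisymm
    nth_rewrite 1 [← hB.generatedFace_U hdec]
    refine generatedFace_subset hface (Set.singleton_subset_iff.2 ?_)
    rw [← hyU]
    refine face_sum_mem hface fun k _ => ?_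
    by_cases hk : 0 < e k w
    · obtain ⟨c, hc, hyc⟩ := (hx k hk).2
      rw [hyc]
      exact face_smul_mem hface hc (subset_generatedFace _ (Or.inr ⟨k, by simp [s, hk], rfl⟩))
    · refine subset_generatedFace _ (Or.inl ⟨hy k, ?_⟩)
      rw [hB.symm, hye]
      exact le_antisymm (not_lt.1 hk) (he.1.1 k w hw).1
  rw [hfull, ← Set.ncard_coe_finset] at hle
  have h1 : (s : Set (Fin n)) = {j | 0 < e j w} := by simp [s]
  rw [h1] at hle
  have := hB.rank_add_rank_orthogonal_le hdec hw
  omega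

theorem IsSelfDualForm.measurementMaxEntropy_eq [FiniteDimensional ℝ A]
    (hB : S.IsSelfDualForm B U) (hdec : S.ClassicalDecomposability)
    (hrank : ∀ F : Set A, IsFace S.cone F → ∀ w ∈ S.pureStates,
      S.rank (S.faceJoin F w) ≤ S.rank F + 1) {w : A} (hw : w ∈ S.states) :
    S.measurementMaxEntropy w = S.spectralMaxEntropy w := by
  have hwc := states_subset_cone hw
  -- Decomposing in the span of the whole cone gives a maximal frame, with zero coefficients
  -- allowed; measuring in it returns exactly the coefficients `c`.
  obtain ⟨n, v, c, hv, hgen, hwv⟩ := hB.exists_span_decomposition hdec S.isFace_cone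
    (Submodule.subset_span hwc)
  have hfine := hB.isFineGrained hv (hB.sum_eq_of_generates_cone hv hgen)
  have happ : ∀ i, B (v i) w = c i := fun i => by rw [hwv]; exact hv.apply_combination c i
  have hd : S.IsClassicalDecomposition w c v := by
    refine ⟨⟨fun i => happ i ▸ hB.nonneg _ (hv.mem_cone i) _ hwc, ?_⟩, hB.isFrame hv, hwv⟩
    have := unit_state hw
    rw [hwv, map_sum] at this
    simpa [unit_pure (hv.pure _)] using this
  rw [hB.spectralMaxEntropy_eq hdec hw]
  apply le_antisymm
  · have := measurementMaxEntropy_le w hfine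
    simp only [happ] at this
    exact this.trans_eq (hB.classicalMaxEntropy_eq hd)
  · refine le_csInf ⟨_, n, _, hfine, rfl⟩ ?_
    rintro _ ⟨m, e, he, rfl⟩
    exact logb_natCast_mono (hB.rank_le_of_isFineGrained hdec hrank hwc he)

theorem IsSelfDualForm.exists_short_decomposition (hB : S.IsSelfDualForm B U)
    [FiniteDimensional ℝ A] (hdec : S.ClassicalDecomposability) (hF : IsFace S.cone F) {w : A}
    (hw : w ∈ S.states) (hwF : w ∈ F) :
    ∃ m : ℕ, m ≤ S.rank F ∧ ∃ (p : Fin m → ℝ) (x : Fin m → A),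
      S.IsClassicalDecomposition w p x := by
  obtain ⟨k, v, c, hv, hc, hwv, hgen⟩ := hB.exists_decomposition hdec (states_subset_cone hw)
  refine ⟨k, ?_, c, v, ⟨fun i => (hc i).le, ?_⟩, hB.isFrame hv, hwv⟩
  · have hsub : generatedFace S.cone {w} ⊆ F :=
      generatedFace_subset hF (Set.singleton_subset_iff.2 hwF)
    simpa using hB.card_le_rank hdec hF hv fun i =>
      hsub (hgen.le (subset_generatedFace _ ⟨i, rfl⟩))
  · have := unit_state hw
    rw [hwv, map_sum] at this
    simpa [unit_pure (hv.pure _)] using this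

end GPT

theorem mainTheorem9 {A : Type*} [NormedAddCommGroup A] [NormedSpace ℝ A] [FiniteDimensional ℝ A]
    (S : GPT A) (hdec : S.ClassicalDecomposability) (hsym : S.StrongSymmetry) :
    -- the rank of a face is well defined
    (∀ F : Set A, IsFace S.cone F →
      S.GeneratedByFrame F (S.rank F) ∧ ∀ n : ℕ, S.GeneratedByFrame F n → n = S.rank F) ∧
    -- the spectral max-entropy can be computed from any classical decomposition
    (∀ w ∈ S.states, ∀ (n : ℕ) (p : Fin n → ℝ) (v : Fin n → A),
      S.IsClassicalDecomposition w p v → classicalMaxEntropy p = S.spectralMaxEntropy w) ∧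
    -- under the covering property, `n` pure states generate a face of rank at most `n`, all of
    -- whose states have a classical decomposition into at most `n` pure states
    (S.CoveringProperty → ∀ (n : ℕ) (v : Fin n → A), (∀ i, v i ∈ S.pureStates) →
      S.rank (generatedFace S.cone (Set.range v)) ≤ n ∧
      ∀ w ∈ S.states, w ∈ generatedFace S.cone (Set.range v) →
        ∃ m : ℕ, m ≤ n ∧ ∃ (p : Fin m → ℝ) (x : Fin m → A), S.IsClassicalDecomposition w p x) ∧
    -- in terms of ranks: adjoining a pure state raises the rank of a face by at most one
    (S.CoveringProperty ↔ ∀ F : Set A, IsFace S.cone F → ∀ w ∈ S.pureStates,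
      S.rank (S.faceJoin F w) ≤ S.rank F + 1) ∧
    -- the covering property holds iff the three max-entropies coincide
    (S.CoveringProperty ↔ ∀ w ∈ S.states,
      S.decompositionMaxEntropy w = S.measurementMaxEntropy w ∧
      S.measurementMaxEntropy w = S.spectralMaxEntropy w) ∧
    (S.CoveringProperty ↔ ∀ w ∈ S.states,
      S.decompositionMaxEntropy w = S.spectralMaxEntropy w) := by
  obtain ⟨B, U, hB⟩ := GPT.exists_isSelfDualForm hdec hsym
  have hcov := GPT.coveringProperty_iff_rank hB hdec
  have hent : (∀ w ∈ S.states, S.decompositionMaxEntropy w = S.spectralMaxEntropy w) →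
      S.CoveringProperty := fun h =>
    hcov.2 fun F hF w hw => hB.rank_le_of_maxEntropy hdec h hF hw
  refine ⟨fun F hF => ?_, fun w hw n p v hd => ?_, fun h n v hv => ?_, hcov,
    ⟨fun h w hw => ?_, fun h => hent fun w hw => (h w hw).1.trans (h w hw).2⟩,
    ⟨fun h w hw => hB.decompositionMaxEntropy_eq hdec (hcov.1 h) hw, hent⟩⟩
  · obtain ⟨w, hw, hwF⟩ := hB.exists_frame_of_rank hdec hF
    exact ⟨⟨w, hB.isFrame hw, hwF⟩, fun n hn => hB.rank_eq_of_generatedByFrame hn⟩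
  · rw [hB.classicalMaxEntropy_eq hd, hB.spectralMaxEntropy_eq hdec hw]
  · have hle : S.rank (generatedFace S.cone (Set.range v)) ≤ n := by
      simpa using GPT.rank_generatedFace_image_le hB (hcov.1 h) Finset.univ (v := v)
        fun i _ => hv i
    refine ⟨hle, fun w hw hwF => ?_⟩
    obtain ⟨m, hm, hdecomp⟩ := hB.exists_short_decomposition hdec
      (GPT.isFace_generatedFace (Set.range_subset_iff.2 fun i => GPT.pure_mem_cone (hv i))) hw hwF
    exact ⟨m, hm.trans hle, hdecomp⟩
  · have h1 := hB.decompositionMaxEntropy_eq hdec (hcov.1 h) hw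
    have h2 := hB.measurementMaxEntropy_eq hdec (hcov.1 h) hw
    exact ⟨h1.trans h2.symm, h2⟩
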